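/- For $v=(v_1,v_2)\in\mathbb R^2$ write $v^\perp=(-v_2,v_1)$. Let $E:[0,\infty)\times\mathbb R^2\to\mathbb R^2$ be a given field. For $\varepsilon>0$, $\Delta t>0$ and $x^0_\varepsilon,v^0_\varepsilon\in\mathbb R^2$, let $(x_\varepsilon,v_\varepsilon)$ be the solution on $[0,\infty)$ of $$\varepsilon x_\varepsilon'(t)=v_\varepsilon(t),\qquad \varepsilon v_\varepsilon'(t)=E(t,x_\varepsilon(t))-\tfrac1\varepsilon v_\varepsilon^\perp(t),\qquad x_\varepsilon(0)=x_\varepsilon^0,\quad v_\varepsilon(0)=v_\varepsilon^0,$$ and let $(x_\varepsilon^n,v_\varepsilon^n)_{n\ge0}$ be the solution, starting from the same $(x_\varepsilon^0,v_\varepsilon^0)$, of the scheme $$\frac{x_\varepsilon^{n+1}-x_\varepsilon^n}{\Delta t}=\frac{v_\varepsilon^{n+1}}{\varepsilon},\qquad \varepsilon\,\frac{v_\varepsilon^{n+1}-v_\varepsilon^n}{\Delta t}=E(t_n,x_\varepsilon^n)-\frac{(v_\varepsilon^{n+1})^\perp}{\varepsilon},\qquad t_n=n\Delta t .$$ Put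 $y_\varepsilon(t)=x_\varepsilon(t)-\varepsilon v_\varepsilon^\perp(t)$ and $y_\varepsilon^n=x_\varepsilon^n-\varepsilon(v_\varepsilon^n)^\perp$. Let $T,V\in\mathbb R$. (Fields in $W^{k,\infty}$, $k\geq 1$, are identified with their representative that is continuous on $[0,\infty)\times\mathbb R^2$.) (i) Let $E\in W^{1,\infty}((0,\infty)\times\mathbb R^2)$. For every $c>0$ there is a constant $C>0$, depending only on $E$, $T$, $V$ and $c$, such that for all $\varepsilon>0$, $\Delta t>0$, all initial data with $\|v_\varepsilon^0\|\le V$ and all $n\ge0$ with $t_n\le T$, $$\|x_\varepsilon^n-x_\varepsilon(t_n)\|\le C(1+\varepsilon)\begin{cases}\frac{\Delta t}{\varepsilon^3}(1+\varepsilon^2)&\text{if }\Delta t\le c\,\varepsilon^4,\\ \varepsilon&\text{if }c^{-1}\varepsilon^4\le\Delta t\le c\,\varepsilon,\\ \Delta t&\text{if }c^{-1}\varepsilon\le\Delta t\end{cases}$$ (each bound holds whenever its condition does). Moreover there is a constant $C>0$, depending only on $E$, $T$ and $V$, such that $\|x_\varepsilon^n-x_\varepsilon(t_n)\|\le C(\Delta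 t)^{1/4}$ for all such $\varepsilon$, $\Delta t$, initial data and $n$. (ii) Let $E\in W^{2,\infty}((0,\infty)\times\mathbb R^2)$. For every $c>0$ there is a constant $C>0$, depending only on $E$, $T$, $V$ and $c$, such that for all $\varepsilon>0$, $\Delta t>0$, all initial data with $\|v_\varepsilon^0\|\le V$ and all $n\ge0$ with $t_n\le T$, $$\|y_\varepsilon^n-y_\varepsilon(t_n)\|\le C(1+\varepsilon^2)\begin{cases}\frac{\Delta t}{\varepsilon^3}(1+\varepsilon)&\text{if }\Delta t\le c\,\varepsilon^5,\\ \varepsilon^2&\text{if }c^{-1}\varepsilon^5\le\Delta t\le c\,\varepsilon^2,\\ \Delta t&\text{if }c^{-1}\varepsilon^2\le\Delta t\end{cases}$$ (each bound holds whenever its condition does). Moreover there is a constant $C>0$, depending only on $E$, $T$ and $V$, such that $\|y_\varepsilon^n-y_\varepsilon(t_n)\|\le C(\Delta t)^{2/5}$ for all such $\varepsilon$, $\Delta t$, initial data and $n$. -/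

import Mathlib

open MeasureTheory Set
open scoped ContDiff

noncomputable section

/-- The plane `ℝ²` with its Euclidean norm. -/
abbrev Plane : Type := EuclideanSpace ℝ (Fin 2)

/-- The rotated vector `v^⊥ = (-v₂, v₁)`. -/
def perp (v : Plane) : Plane := !₂[-v 1, v 0]

/-- `g` is the weak (distributional) derivative of `f` in the direction `e` on the open set `Ω`:
`∫ (∂_e φ) f = - ∫ φ g` for every test function `φ ∈ C_c^∞(Ω)`. -/
def HasWeakDeriv {X F : Type*} [NormedAddCommGroup X] [NormedSpace ℝ X] [MeasureSpace X]
    [NormedAddCommGroup F] [NormedSpace ℝ F] (Ω : Set X) (f g : X → F) (e : X) : Prop :=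
  ∀ φ : X → ℝ, ContDiff ℝ ∞ φ → HasCompactSupport φ → tsupport φ ⊆ Ω →
    ∫ z, (fderiv ℝ φ z e) • f z = -∫ z, φ z • g z

/-- The Sobolev space `W^{k,∞}(Ω)`: `f` and all its weak derivatives up to order `k` are
(measurable and) essentially bounded on `Ω`. -/
def MemWkInfty {X F : Type*} [NormedAddCommGroup X] [NormedSpace ℝ X] [MeasureSpace X]
    [NormedAddCommGroup F] [NormedSpace ℝ F] (Ω : Set X) : ℕ → (X → F) → Prop
  | 0, f => MemLp f ⊤ (volume.restrict Ω)
  | k + 1, f => MemLp f ⊤ (volume.restrict Ω) ∧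
      ∀ e : X, ∃ g : X → F, HasWeakDeriv Ω f g e ∧ MemWkInfty Ω k g

/-- `E ∈ W^{k,∞}` as a field of time `t ≥ 0` and position `x ∈ ℝ²`. A class in `W^{k,∞}`, `k ≥ 1`,
has exactly one representative that is continuous on `[0,∞) × ℝ²`, and this is the one whose point
values enter the equations of motion. -/
structure FieldInWkInfty (k : ℕ) (E : ℝ → Plane → Plane) : Prop where
  continuousOn : ContinuousOn (fun z : ℝ × Plane => E z.1 z.2) (Ici 0 ×ˢ univ)
  mem : MemWkInfty (Ioi 0 ×ˢ univ) k (fun z : ℝ × Plane => E z.1 z.2)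

/-- `(x, v)` solves on `[0,∞)` the characteristic system
`ε x' = v`, `ε v' = E(t, x) - v^⊥ / ε`, `x(0) = x₀`, `v(0) = v₀`. -/
structure IsCharacteristic (E : ℝ → Plane → Plane) (ε : ℝ) (x₀ v₀ : Plane)
    (x v : ℝ → Plane) : Prop where
  init_x : x 0 = x₀
  init_v : v 0 = v₀
  deriv_x : ∀ t, 0 ≤ t → HasDerivWithinAt x (ε⁻¹ • v t) (Ici 0) t
  deriv_v : ∀ t, 0 ≤ t →
    HasDerivWithinAt v (ε⁻¹ • (E t (x t) - ε⁻¹ • perp (v t))) (Ici 0) t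

/-- `(xⁿ, vⁿ)` solves the first-order semi-implicit scheme with time step `Δt` and `tₙ = n Δt`:
`(xⁿ⁺¹ - xⁿ)/Δt = vⁿ⁺¹/ε`, `ε (vⁿ⁺¹ - vⁿ)/Δt = E(tₙ, xⁿ) - (vⁿ⁺¹)^⊥/ε`, `x⁰ = x₀`, `v⁰ = v₀`. -/
structure IsImexScheme (E : ℝ → Plane → Plane) (ε Δt : ℝ) (x₀ v₀ : Plane)
    (x v : ℕ → Plane) : Prop where
  init_x : x 0 = x₀
  init_v : v 0 = v₀
  step_x : ∀ n : ℕ, Δt⁻¹ • (x (n + 1) - x n) = ε⁻¹ • v (n + 1)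
  step_v : ∀ n : ℕ, ε • (Δt⁻¹ • (v (n + 1) - v n)) =
    E (n * Δt) (x n) - ε⁻¹ • perp (v (n + 1))

/-- The guiding center `y = x - ε v^⊥`. -/
def guidingCenter (ε : ℝ) (x v : Plane) : Plane := x - ε • perp v

end

/-! ### The rotation `perp` -/

/-! The magnetic term is stiff in `v` but disappears from the guiding center: `y' = -perp (E t x)`,
and the scheme reproduces this exactly, as an explicit Euler step for `y`. Since `x = y + ε • perp
v`, everything depends on how strongly `v` feeds back into `y`.

Velocities are bounded by a multiple of `1 + ε`, uniformly in `Δt`. The quantity `w = v + ε • perp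
E` is rotated at frequency `1/ε²` and otherwise changes at rate at most `L (ε + ‖v‖)`. Rotation
preserves the norm, and the implicit step `I + a perp` has a contractive inverse.

Two bounds then compete. Classical consistency and stability, in the norm `‖δy‖ + ε‖δv‖`, give `Δt
(1 + ε⁻³)` (`error_le_of_smooth_regime`). Replacing `E t x` by `E t y` costs `O(ε ‖v‖)`, so both
trajectories shadow the same guiding center dynamics and the error in `x` is `Δt + ε (1 + ε)`
(`error_le_of_stiff_regime`).

For `E` in `W^{2,∞}` the second bound improves in `y`. The first order term `ε A (perp v)` of `E t x
- E t y` oscillates: by the velocity equation `ε perp v = ε² E - ε³ v'`. Hence `y - ε³ perp (A v)`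
solves the guiding center equation up to `O(ε²)`, and summation by parts does the same for the
scheme, giving `(Δt + ε²)(1 + ε²)` (`guidingCenter_error_le`).

The regimes in terms of `c` are read off from these bounds; balancing them at `ε = Δt^(1/4)`,
respectively `ε = Δt^(1/5)`, gives the uniform rates. Mollification turns weak derivatives into the
Lipschitz and Taylor estimates used above. -/

theorem perp_add (v w : Plane) : perp (v + w) = perp v + perp w := by
  ext i; fin_cases i <;> simp [perp, add_comm]

theorem perp_smul (a : ℝ) (v : Plane) : perp (a • v) = a • perp v := by
  ext i; fin_cases i <;> simp [perp]

theorem perp_neg (v : Plane) : perp (-v) = -perp v := by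
  ext i; fin_cases i <;> simp [perp]

theorem perp_sub (v w : Plane) : perp (v - w) = perp v - perp w := by
  rw [sub_eq_add_neg, perp_add, perp_neg, sub_eq_add_neg]

theorem perp_perp (v : Plane) : perp (perp v) = -v := by
  ext i; fin_cases i <;> simp [perp]

theorem norm_perp (v : Plane) : ‖perp v‖ = ‖v‖ := by
  simp [EuclideanSpace.norm_eq, perp, Fin.sum_univ_two, add_comm]

/-- `perp` as a continuous linear map. -/
noncomputable def perpL : Plane →L[ℝ] Plane :=
  LinearMap.toContinuousLinearMap
    { toFun := perp, map_add' := perp_add, map_smul' := perp_smul }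

@[simp] theorem perpL_apply (v : Plane) : perpL v = perp v := rfl

theorem norm_add_smul_perp_sq (a : ℝ) (v : Plane) :
    ‖v + a • perp v‖ ^ 2 = (1 + a ^ 2) * ‖v‖ ^ 2 := by
  simp only [EuclideanSpace.norm_sq_eq, Fin.sum_univ_two, Real.norm_eq_abs, sq_abs]
  simp [perp]; ring

/-- Orthogonality of `v` and `perp v` makes the implicit magnetic step invertible with a contractive
inverse for every `a`, so no restriction on `Δt / ε²` is needed. -/
theorem norm_le_norm_add_smul_perp (a : ℝ) (v : Plane) : ‖v‖ ≤ ‖v + a • perp v‖ := by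
  apply le_of_sq_le_sq _ (norm_nonneg _)
  rw [norm_add_smul_perp_sq]
  nlinarith [mul_nonneg (sq_nonneg a) (sq_nonneg ‖v‖)]

/-- The sharp factor is the square root of `1 + a²`. What matters is that the excess is quadratic in
`a`, so that it does not contribute to a right derivative. -/
theorem norm_add_smul_perp_le (a : ℝ) (v : Plane) :
    ‖v + a • perp v‖ ≤ (1 + a ^ 2) * ‖v‖ := by
  apply le_of_sq_le_sq _ (by positivity)
  rw [norm_add_smul_perp_sq, mul_pow]
  have : 0 ≤ a ^ 2 := sq_nonneg a
  gcongr
  nlinarith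

/-! ### A discrete Grönwall inequality -/

theorem le_exp_mul_of_succ_le {a : ℕ → ℝ} {κ b : ℝ} (hκ : 0 ≤ κ) (hb : 0 ≤ b) (ha : 0 ≤ a 0)
    {N : ℕ} (h : ∀ n < N, a (n + 1) ≤ (1 + κ) * a n + b) :
    ∀ n ≤ N, a n ≤ Real.exp (n * κ) * (a 0 + n * b) := by
  intro n
  induction n with
  | zero => intro _; simp
  | succ n ih =>
    intro hn
    have h1 := ih (by omega)
    have h2 := h n (by omega)
    have h3 : (1 + κ) * Real.exp (n * κ) ≤ Real.exp ((n + 1 : ℕ) * κ) := by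
      push_cast
      rw [show ((n : ℝ) + 1) * κ = κ + n * κ by ring, Real.exp_add]
      gcongr
      linarith [Real.add_one_le_exp κ]
    have h4 : (1 : ℝ) ≤ Real.exp ((n + 1 : ℕ) * κ) := Real.one_le_exp (by positivity)
    have h5 : 0 ≤ a 0 + n * b := by positivity
    calc a (n + 1) ≤ (1 + κ) * (Real.exp (n * κ) * (a 0 + n * b)) + b := by
          have := mul_le_mul_of_nonneg_left h1 (by linarith : (0 : ℝ) ≤ 1 + κ)
          linarith
      _ = (1 + κ) * Real.exp (n * κ) * (a 0 + n * b) + 1 * b := by ring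
      _ ≤ Real.exp ((n + 1 : ℕ) * κ) * (a 0 + n * b) + Real.exp ((n + 1 : ℕ) * κ) * b := by
          gcongr
      _ = _ := by push_cast; ring

/-- `E` is bounded by `M` and `L`-Lipschitz in time and position, for nonnegative times. -/
structure BddLip (E : ℝ → Plane → Plane) (M L : ℝ) : Prop where
  bdd_pos : 0 < M
  lip_pos : 0 < L
  bdd : ∀ t, 0 ≤ t → ∀ x, ‖E t x‖ ≤ M
  lip : ∀ s t, 0 ≤ s → 0 ≤ t → ∀ x y, ‖E s x - E t y‖ ≤ L * (|s - t| + ‖x - y‖)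

/-! ### The scheme -/

namespace IsImexScheme

variable {E : ℝ → Plane → Plane} {ε Δt : ℝ} {x₀ v₀ : Plane} {x v : ℕ → Plane}

theorem x_succ (h : IsImexScheme E ε Δt x₀ v₀ x v) (hΔ : 0 < Δt) (n : ℕ) :
    x (n + 1) = x n + (Δt / ε) • v (n + 1) := by
  have := congrArg (Δt • ·) (h.step_x n)
  simp only [smul_smul, mul_inv_cancel₀ hΔ.ne', one_smul] at this
  rw [← sub_eq_iff_eq_add', this, div_eq_mul_inv]

theorem v_succ (h : IsImexScheme E ε Δt x₀ v₀ x v) (hε : 0 < ε) (hΔ : 0 < Δt) (n : ℕ) :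
    ε • (v (n + 1) - v n) = Δt • E (n * Δt) (x n) - (Δt / ε) • perp (v (n + 1)) := by
  have := congrArg (Δt • ·) (h.step_v n)
  have e : Δt * (ε * Δt⁻¹) = ε := by field_simp
  simp only [smul_smul, smul_sub, e] at this
  rw [smul_sub, this, div_eq_mul_inv]

/-- Rotating the implicit magnetic term turns it into a multiple of `v (n + 1)` that cancels the
position increment exactly. -/
theorem guidingCenter_succ (h : IsImexScheme E ε Δt x₀ v₀ x v) (hε : 0 < ε) (hΔ : 0 < Δt)
    (n : ℕ) : guidingCenter ε (x (n + 1)) (v (n + 1)) =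
      guidingCenter ε (x n) (v n) - Δt • perp (E (n * Δt) (x n)) := by
  have h1 := congrArg perp (h.v_succ hε hΔ n)
  simp only [perp_smul, perp_sub, perp_perp, smul_sub] at h1
  rw [guidingCenter, guidingCenter, h.x_succ hΔ n, sub_eq_iff_eq_add.1 h1]
  module

/-- The electric drift `-ε • perp E` is the fixed point of the implicit velocity step with frozen
field; subtracting it leaves a pure linear step. -/
theorem add_perp_succ (h : IsImexScheme E ε Δt x₀ v₀ x v) (hε : 0 < ε) (hΔ : 0 < Δt) (n : ℕ) :
    (v (n + 1) + ε • perp (E (n * Δt) (x n))) +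
      (Δt / ε ^ 2) • perp (v (n + 1) + ε • perp (E (n * Δt) (x n))) =
    v n + ε • perp (E (n * Δt) (x n)) := by
  have h1 := congrArg (ε⁻¹ • ·) (h.v_succ hε hΔ n)
  simp only [smul_smul, inv_mul_cancel₀ hε.ne', one_smul, smul_sub] at h1
  rw [sub_eq_iff_eq_add] at h1
  simp only [perp_add, perp_smul, perp_perp]
  have e1 : Δt / ε ^ 2 = ε⁻¹ * (Δt / ε) := by field_simp
  have e2 : (Δt / ε ^ 2 * ε) = ε⁻¹ * Δt := by field_simp
  rw [smul_add, smul_smul, e2, e1]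
  generalize perp (v (n+1)) = p at *
  rw [h1]
  module

/-- A step contracts, and then the field is updated. Positions move by `(Δt / ε) ‖v‖`, but the field
enters with a factor `ε`, so the growth rate `L * Δt` is independent of `ε`. -/
theorem norm_add_perp_le (h : IsImexScheme E ε Δt x₀ v₀ x v) (hε : 0 < ε) (hΔ : 0 < Δt)
    {M L : ℝ} (hE : BddLip E M L) (n : ℕ) :
    ‖v n + ε • perp (E (n * Δt) (x n))‖ ≤
      Real.exp (n * (L * Δt)) * (‖v₀‖ + ε * M + n * (L * Δt * (ε * (1 + M)))) := by
  have hM := hE.bdd_pos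
  have hL := hE.lip_pos
  have key := le_exp_mul_of_succ_le (a := fun n : ℕ => ‖v n + ε • perp (E (n * Δt) (x n))‖)
    (κ := L * Δt) (b := L * Δt * (ε * (1 + M))) (by positivity) (by positivity)
    (norm_nonneg _) (N := n) (by
      intro k _
      have h1 := norm_le_norm_add_smul_perp (Δt / ε ^ 2)
        (v (k + 1) + ε • perp (E (k * Δt) (x k)))
      rw [h.add_perp_succ hε hΔ k] at h1
      set w := ‖v k + ε • perp (E (k * Δt) (x k))‖
      have hk : (0 : ℝ) ≤ k * Δt := by positivity
      have hk1 : (0 : ℝ) ≤ (k + 1 : ℕ) * Δt := by positivity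
      have h2 : ‖v (k + 1)‖ ≤ w + ε * M := by
        have : v (k + 1) = (v (k + 1) + ε • perp (E (k * Δt) (x k)))
          - ε • perp (E (k * Δt) (x k)) := by module
        rw [this]
        refine (norm_sub_le _ _).trans ?_
        rw [norm_smul, norm_perp, Real.norm_of_nonneg hε.le]
        gcongr
        exact hE.bdd _ hk _
      have h3 := hE.lip ((k + 1 : ℕ) * Δt) (k * Δt) hk1 hk (x (k + 1)) (x k)
      have e1 : |((k + 1 : ℕ) * Δt - k * Δt)| = Δt := by
        push_cast; rw [show ((k + 1) * Δt - k * Δt : ℝ) = Δt by ring, abs_of_pos hΔ]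
      have e2 : ‖x (k + 1) - x k‖ = Δt / ε * ‖v (k + 1)‖ := by
        rw [h.x_succ hΔ k, add_sub_cancel_left, norm_smul, Real.norm_of_nonneg (by positivity)]
      rw [e1, e2] at h3
      have e3 : v (k + 1) + ε • perp (E ((k + 1 : ℕ) * Δt) (x (k + 1))) =
        (v (k + 1) + ε • perp (E (k * Δt) (x k))) +
          ε • perp (E ((k + 1 : ℕ) * Δt) (x (k + 1)) - E (k * Δt) (x k)) := by
        rw [perp_sub]; module
      calc ‖v (k + 1) + ε • perp (E ((k + 1 : ℕ) * Δt) (x (k + 1)))‖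
          ≤ w + ε * (L * (Δt + Δt / ε * ‖v (k + 1)‖)) := by
            rw [e3]
            refine (norm_add_le _ _).trans ?_
            rw [norm_smul ε, norm_perp, Real.norm_of_nonneg hε.le]
            gcongr
        _ ≤ w + ε * (L * (Δt + Δt / ε * (w + ε * M))) := by gcongr
        _ = (1 + L * Δt) * w + L * Δt * (ε * (1 + M)) := by field_simp; ring) n le_rfl
  refine key.trans ?_
  have h0 : ‖v 0 + ε • perp (E ((0 : ℕ) * Δt) (x 0))‖ ≤ ‖v₀‖ + ε * M := by
    rw [h.init_v]
    refine (norm_add_le _ _).trans ?_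
    rw [norm_smul, norm_perp, Real.norm_of_nonneg hε.le]
    gcongr
    exact hE.bdd _ (by simp) _
  gcongr

end IsImexScheme

/-! ### The exact characteristics: guiding center equation and velocity bound. -/

namespace IsCharacteristic

variable {E : ℝ → Plane → Plane} {ε : ℝ} {x₀ v₀ : Plane} {x v : ℝ → Plane}

theorem hasDerivWithinAt_guidingCenter (h : IsCharacteristic E ε x₀ v₀ x v) (hε : 0 < ε)
    {t : ℝ} (ht : 0 ≤ t) :
    HasDerivWithinAt (fun s => guidingCenter ε (x s) (v s)) (-perp (E t (x t))) (Ici 0) t := by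
  have h1 := (h.deriv_x t ht).sub
    ((perpL.hasFDerivAt.comp_hasDerivWithinAt t (h.deriv_v t ht)).const_smul ε)
  refine h1.congr_deriv ?_
  simp only [perpL_apply, perp_smul, perp_sub, perp_perp, smul_sub, smul_smul]
  have e : ε * ε⁻¹ = 1 := mul_inv_cancel₀ hε.ne'
  rw [← mul_assoc, e]
  module

theorem continuousOn_add_perp (h : IsCharacteristic E ε x₀ v₀ x v) {M L : ℝ}
    (hE : BddLip E M L) :
    ContinuousOn (fun t => v t + ε • perp (E t (x t))) (Ici 0) := by
  have hx : ContinuousOn x (Ici 0) := fun t ht => (h.deriv_x t ht).continuousWithinAt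
  have hv : ContinuousOn v (Ici 0) := fun t ht => (h.deriv_v t ht).continuousWithinAt
  have hEx : ContinuousOn (fun t => E t (x t)) (Ici 0) := by
    intro t ht
    rw [ContinuousWithinAt, tendsto_iff_norm_sub_tendsto_zero]
    have h1 : Filter.Tendsto (fun s => L * (|s - t| + ‖x s - x t‖)) (nhdsWithin t (Ici 0))
        (nhds 0) := by
      have : ContinuousWithinAt (fun s => L * (|s - t| + ‖x s - x t‖)) (Ici 0) t := by
        have := hx t ht
        fun_prop
      simpa [ContinuousWithinAt] using this
    refine squeeze_zero' (Filter.Eventually.of_forall fun _ => norm_nonneg _) ?_ h1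
    filter_upwards [self_mem_nhdsWithin] with s hs
    exact hE.lip s t hs ht _ _
  exact hv.add ((perpL.continuous.comp_continuousOn hEx).const_smul ε)

/-- The field is only Lipschitz and the norm is not smooth at zero, so difference quotients are
estimated instead of derivatives. The rotation contributes only at second order in `z - t`, which
leaves the variation of `ε • perp E` along the trajectory. -/
theorem liminf_slope_norm_add_perp (h : IsCharacteristic E ε x₀ v₀ x v) (hε : 0 < ε) {M L : ℝ}
    (hE : BddLip E M L) {t : ℝ} (ht : 0 ≤ t) {r : ℝ} (hr : L * (ε + ‖v t‖) < r) :
    ∀ᶠ z in nhdsWithin t (Ioi t),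
      (z - t)⁻¹ * (‖v z + ε • perp (E z (x z))‖ - ‖v t + ε • perp (E t (x t))‖) < r := by
  set w := v t + ε • perp (E t (x t)) with hw
  have hsub : Ioi t ⊆ Ici 0 := fun s hs => ht.trans (le_of_lt hs)
  have hx := (hasDerivWithinAt_iff_tendsto_slope' (self_notMem_Ioi)).1 ((h.deriv_x t ht).mono hsub)
  have hv := (hasDerivWithinAt_iff_tendsto_slope' (self_notMem_Ioi)).1 ((h.deriv_v t ht).mono hsub)
  set v' := ε⁻¹ • (E t (x t) - ε⁻¹ • perp (v t)) with hv'
  have e1 : v' = -((ε ^ 2)⁻¹ • perp w) := by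
    have e : ε⁻¹ = (ε ^ 2)⁻¹ * ε := by field_simp
    have e' : ε⁻¹ * ε⁻¹ = (ε ^ 2)⁻¹ := by field_simp
    rw [hw, hv', perp_add, perp_smul, perp_perp, smul_sub, smul_smul, e']
    nth_rw 1 [e]
    module
  have hlim : Filter.Tendsto (fun z => (z - t) * (ε ^ 4)⁻¹ * ‖w‖ + ‖slope v t z - v'‖
      + ε * (L * (1 + ‖slope x t z‖))) (nhdsWithin t (Ioi t))
      (nhds (0 + ‖v' - v'‖ + ε * (L * (1 + ‖ε⁻¹ • v t‖)))) := by
    have h0 : Filter.Tendsto (fun z => (z - t) * (ε ^ 4)⁻¹ * ‖w‖) (nhdsWithin t (Ioi t))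
        (nhds 0) := by
      have : ContinuousWithinAt (fun z => (z - t) * (ε ^ 4)⁻¹ * ‖w‖) (Ioi t) t := by fun_prop
      simpa [ContinuousWithinAt] using this
    exact (h0.add (hv.sub_const v').norm).add (((hx.norm.const_add 1).const_mul L).const_mul ε)
  have hval : 0 + ‖v' - v'‖ + ε * (L * (1 + ‖ε⁻¹ • v t‖)) < r := by
    refine lt_of_eq_of_lt ?_ hr
    rw [norm_smul, Real.norm_of_nonneg (by positivity)]
    simp
    field_simp
  filter_upwards [hlim.eventually (gt_mem_nhds hval), self_mem_nhdsWithin] with z hz htz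
  refine lt_of_le_of_lt ?_ hz
  have hk : 0 < z - t := sub_pos.2 htz
  set k := z - t with hkdef
  have hz0 : 0 ≤ z := ht.trans (le_of_lt htz)
  have sx : x z - x t = k • slope x t z := by
    rw [slope_def_module, smul_smul, mul_inv_cancel₀ hk.ne', one_smul]
  have sv : v z - v t = k • slope v t z := by
    rw [slope_def_module, smul_smul, mul_inv_cancel₀ hk.ne', one_smul]
  -- A linearised rotation of `w`, the remainder of the first order expansion of `v`, and the change
  -- of the field.
  have hdecomp : v z + ε • perp (E z (x z)) =
      (w + (-(k / ε ^ 2)) • perp w) + k • (slope v t z - v') +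
        ε • perp (E z (x z) - E t (x t)) := by
    rw [smul_sub, ← sv, e1, perp_sub, hw, div_eq_mul_inv]
    module
  have hrot : ‖w + (-(k / ε ^ 2)) • perp w‖ ≤ (1 + (k / ε ^ 2) ^ 2) * ‖w‖ := by
    have := norm_add_smul_perp_le (-(k / ε ^ 2)) w
    rwa [neg_sq] at this
  have hlip := hE.lip z t hz0 ht (x z) (x t)
  rw [← hkdef, abs_of_pos hk, sx, norm_smul, Real.norm_of_nonneg hk.le] at hlip
  have hnorm : ‖v z + ε • perp (E z (x z))‖ ≤ (1 + (k / ε ^ 2) ^ 2) * ‖w‖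
      + k * ‖slope v t z - v'‖ + ε * (L * (k + k * ‖slope x t z‖)) := by
    rw [hdecomp]
    refine (norm_add₃_le).trans ?_
    rw [norm_smul k, norm_smul ε, norm_perp, Real.norm_of_nonneg hε.le, Real.norm_of_nonneg hk.le]
    gcongr
  rw [inv_mul_le_iff₀ hk]
  refine (sub_le_sub_right hnorm ‖w‖).trans (le_of_eq ?_)
  field_simp
  ring

theorem norm_add_perp_le (h : IsCharacteristic E ε x₀ v₀ x v) (hε : 0 < ε) {M L : ℝ}
    (hE : BddLip E M L) {t : ℝ} (ht : 0 ≤ t) :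
    ‖v t + ε • perp (E t (x t))‖ ≤ Real.exp (L * t) * (‖v₀‖ + ε * M + ε * (1 + M)) := by
  have hM := hE.bdd_pos
  have hL := hE.lip_pos
  have hnv : ∀ s, 0 ≤ s → ‖v s‖ ≤ ‖v s + ε • perp (E s (x s))‖ + ε * M := by
    intro s hs
    have : v s = (v s + ε • perp (E s (x s))) - ε • perp (E s (x s)) := by module
    nth_rw 1 [this]
    refine (norm_sub_le _ _).trans ?_
    rw [norm_smul ε, norm_perp, Real.norm_of_nonneg hε.le]
    gcongr
    exact hE.bdd _ hs _
  have key := le_gronwallBound_of_liminf_deriv_right_le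
    (f := fun s => ‖v s + ε • perp (E s (x s))‖) (f' := fun s => L * (ε + ‖v s‖))
    (δ := ‖v₀‖ + ε * M) (K := L) (ε := L * (ε * (1 + M))) (a := 0) (b := t)
    ((h.continuousOn_add_perp hE).mono Icc_subset_Ici_self).norm
    (fun s hs r hr => (h.liminf_slope_norm_add_perp hε hE hs.1 hr).frequently)
    (by
      rw [h.init_v]
      refine (norm_add_le _ _).trans ?_
      rw [norm_smul, norm_perp, Real.norm_of_nonneg hε.le]
      gcongr
      exact hE.bdd _ le_rfl _)
    (by
      intro s hs
      have := mul_le_mul_of_nonneg_left (hnv s hs.1) hL.le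
      linarith)
    t ⟨ht, le_rfl⟩
  refine key.trans ?_
  rw [gronwallBound_of_K_ne_0 hL.ne', sub_zero]
  simp only
  rw [mul_div_cancel_left₀ _ hL.ne']
  have : 0 ≤ ε * (1 + M) := by positivity
  linarith

end IsCharacteristic

/-! ### Error estimates -/

theorem norm_sub_le_of_hasDerivWithinAt_Ici {f f' : ℝ → Plane} {a b C : ℝ} (ha : 0 ≤ a)
    (hab : a ≤ b) (hf : ∀ s, 0 ≤ s → HasDerivWithinAt f (f' s) (Ici 0) s)
    (hC : ∀ s, a ≤ s → s ≤ b → ‖f' s‖ ≤ C) : ‖f b - f a‖ ≤ C * (b - a) :=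
  norm_image_sub_le_of_norm_deriv_le_segment'
    (fun s hs => (hf s (ha.trans hs.1)).mono fun _ hr => ha.trans hr.1)
    (fun s hs => hC s hs.1 hs.2.le) b ⟨hab, le_rfl⟩

theorem guidingCenter_add (ε : ℝ) (x v : Plane) : guidingCenter ε x v + ε • perp v = x := by
  rw [guidingCenter, sub_add_cancel]

theorem norm_sub_le_guidingCenter {ε : ℝ} (hε : 0 < ε) (x v x' v' : Plane) :
    ‖x - x'‖ ≤ ‖guidingCenter ε x v - guidingCenter ε x' v'‖ + ε * ‖v - v'‖ := by
  have : x - x' = (guidingCenter ε x v - guidingCenter ε x' v') + ε • perp (v - v') := by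
    rw [guidingCenter, guidingCenter, perp_sub]; module
  rw [this]
  refine (norm_add_le _ _).trans ?_
  rw [norm_smul, norm_perp, Real.norm_of_nonneg hε.le]

section Velocity

variable {E : ℝ → Plane → Plane} {M L : ℝ}

/-- A bound for the velocities, uniform in `ε` up to the factor `1 + ε`. -/
noncomputable def velocityBound (M L T V : ℝ) : ℝ :=
  Real.exp (L * T) * (V + M + (L * T + 1) * (1 + M)) + M

theorem norm_le_add_of_add_smul_perp {ε : ℝ} (hε : 0 < ε) (v F : Plane) (hF : ‖F‖ ≤ M) :
    ‖v‖ ≤ ‖v + ε • perp F‖ + ε * M := by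
  have : v = (v + ε • perp F) - ε • perp F := by module
  nth_rw 1 [this]
  refine (norm_sub_le _ _).trans ?_
  rw [norm_smul ε, norm_perp, Real.norm_of_nonneg hε.le]
  gcongr

theorem IsCharacteristic.norm_v_le (hE : BddLip E M L) {ε T V : ℝ} {x₀ v₀ : Plane}
    {x v : ℝ → Plane} (h : IsCharacteristic E ε x₀ v₀ x v) (hε : 0 < ε) (hV : ‖v₀‖ ≤ V)
    {t : ℝ} (ht : 0 ≤ t) (htT : t ≤ T) : ‖v t‖ ≤ velocityBound M L T V * (1 + ε) := by
  have hM := hE.bdd_pos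
  have hL := hE.lip_pos
  have hV0 : 0 ≤ V := (norm_nonneg _).trans hV
  have hT0 : 0 ≤ T := ht.trans htT
  refine (norm_le_add_of_add_smul_perp hε _ (E t (x t)) (hE.bdd t ht _)).trans ?_
  have h1 : Real.exp (L * t) * (‖v₀‖ + ε * M + ε * (1 + M)) ≤
      Real.exp (L * T) * ((V + M + (L * T + 1) * (1 + M)) * (1 + ε)) := by
    gcongr
    have : 0 ≤ (L * T) * (1 + M) * (1 + ε) := by positivity
    have : 0 ≤ V * ε := by positivity
    nlinarith
  have h2 := h.norm_add_perp_le hε hE ht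
  rw [velocityBound]
  linarith

theorem IsImexScheme.norm_v_le (hE : BddLip E M L) {ε Δt T V : ℝ} {x₀ v₀ : Plane}
    {x v : ℕ → Plane} (h : IsImexScheme E ε Δt x₀ v₀ x v) (hε : 0 < ε) (hΔ : 0 < Δt)
    (hV : ‖v₀‖ ≤ V) {n : ℕ} (hn : n * Δt ≤ T) : ‖v n‖ ≤ velocityBound M L T V * (1 + ε) := by
  have hM := hE.bdd_pos
  have hL := hE.lip_pos
  have hV0 : 0 ≤ V := (norm_nonneg _).trans hV
  have hn0 : 0 ≤ n * Δt := by positivity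
  have hT0 : 0 ≤ T := hn0.trans hn
  refine (norm_le_add_of_add_smul_perp hε _ (E (n * Δt) (x n)) (hE.bdd _ hn0 _)).trans ?_
  have h1 : Real.exp (n * (L * Δt)) * (‖v₀‖ + ε * M + n * (L * Δt * (ε * (1 + M)))) ≤
      Real.exp (L * T) * ((V + M + (L * T + 1) * (1 + M)) * (1 + ε)) := by
    rw [show n * (L * Δt) = L * (n * Δt) by ring,
      show n * (L * Δt * (ε * (1 + M))) = L * (n * Δt) * (ε * (1 + M)) by ring]
    have : L * (n * Δt) * (ε * (1 + M)) ≤ L * T * (ε * (1 + M)) := by gcongr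
    gcongr
    have : 0 ≤ (L * T) * (1 + M) := by positivity
    have : 0 ≤ V * ε := by positivity
    nlinarith
  have h2 := h.norm_add_perp_le hε hΔ hE n
  rw [velocityBound]
  linarith

end Velocity

section Errors

variable {E : ℝ → Plane → Plane} {M L ε Δt T B : ℝ} {x₀ v₀ : Plane} {x v : ℝ → Plane}
  {xd vd : ℕ → Plane}

theorem IsCharacteristic.norm_guidingCenter_sub_le (h : IsCharacteristic E ε x₀ v₀ x v)
    (hE : BddLip E M L) (hε : 0 < ε) {a b : ℝ} (ha : 0 ≤ a) (hab : a ≤ b) :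
    ‖guidingCenter ε (x b) (v b) - guidingCenter ε (x a) (v a)‖ ≤ M * (b - a) :=
  norm_sub_le_of_hasDerivWithinAt_Ici (f := fun s => guidingCenter ε (x s) (v s))
    (f' := fun s => -perp (E s (x s))) ha hab
    (fun s hs => h.hasDerivWithinAt_guidingCenter hε hs)
    (fun s hs _ => by rw [norm_neg, norm_perp]; exact hE.bdd s (ha.trans hs) _)

/-- Adding the linear function `s • perp F` leaves a derivative of size `‖E - F‖`, so the mean value
inequality replaces an integral formula. The choice of `F` is left open, since it is the exact field
in one estimate and the numerical one in another. -/
theorem IsCharacteristic.guidingCenter_step (h : IsCharacteristic E ε x₀ v₀ x v)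
    (hε : 0 < ε) {a b C : ℝ} (ha : 0 ≤ a) (hab : a ≤ b) (F : Plane)
    (hC : ∀ s, a ≤ s → s ≤ b → ‖E s (x s) - F‖ ≤ C) :
    ‖guidingCenter ε (x b) (v b) - guidingCenter ε (x a) (v a) + (b - a) • perp F‖ ≤
      C * (b - a) := by
  have := norm_sub_le_of_hasDerivWithinAt_Ici (C := C)
    (f := fun s => guidingCenter ε (x s) (v s) + s • perp F)
    (f' := fun s => -perp (E s (x s)) + (1 : ℝ) • perp F) ha hab
    (fun s hs => (h.hasDerivWithinAt_guidingCenter hε hs).add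
      ((hasDerivWithinAt_id s _).smul_const (perp F)))
    (fun s hs hs' => by
      rw [show -perp (E s (x s)) + (1 : ℝ) • perp F = -perp (E s (x s) - F) by
        rw [perp_sub]; module, norm_neg, norm_perp]
      exact hC s hs hs')
  refine (le_of_eq ?_).trans this
  congr 1
  module

/-- Truncation error of the velocity equation. -/
theorem IsCharacteristic.velocity_step (h : IsCharacteristic E ε x₀ v₀ x v)
    (hε : 0 < ε) {a b C : ℝ} (ha : 0 ≤ a) (hab : a ≤ b) (F : Plane)
    (hC : ∀ s, a ≤ s → s ≤ b → ‖E s (x s) - F‖ + ε⁻¹ * ‖v s - v b‖ ≤ C) :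
    ‖ε • (v b - v a) - (b - a) • F + ((b - a) / ε) • perp (v b)‖ ≤ C * (b - a) := by
  have := norm_sub_le_of_hasDerivWithinAt_Ici (C := C)
    (f := fun s => ε • v s + s • (ε⁻¹ • perp (v b) - F))
    (f' := fun s => ε • (ε⁻¹ • (E s (x s) - ε⁻¹ • perp (v s))) +
      (1 : ℝ) • (ε⁻¹ • perp (v b) - F)) ha hab
    (fun s hs => ((h.deriv_v s hs).const_smul ε).add
      ((hasDerivWithinAt_id s _).smul_const _))
    (fun s hs hs' => by
      rw [show ε • (ε⁻¹ • (E s (x s) - ε⁻¹ • perp (v s))) + (1 : ℝ) • (ε⁻¹ • perp (v b) - F) =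
        (E s (x s) - F) - ε⁻¹ • perp (v s - v b) by
          rw [smul_smul, mul_inv_cancel₀ hε.ne', perp_sub]; module]
      refine (norm_sub_le _ _).trans ?_
      rw [norm_smul, norm_perp, Real.norm_of_nonneg (by positivity)]
      exact hC s hs hs')
  refine (le_of_eq ?_).trans this
  congr 1
  rw [div_eq_mul_inv]
  module

theorem cast_mul_lt {N n : ℕ} (hΔ : 0 < Δt) (hN : N * Δt ≤ T) (hn : n ≤ N) : n * Δt ≤ T :=
  le_trans (by gcongr) hN

/-- The error estimate for fixed `ε`. -/
theorem error_le_of_smooth_regime (hE : BddLip E M L) (hε : 0 < ε) (hΔ : 0 < Δt) (hB : 0 ≤ B)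
    (h : IsCharacteristic E ε x₀ v₀ x v) (hd : IsImexScheme E ε Δt x₀ v₀ xd vd)
    (hv : ∀ t, 0 ≤ t → t ≤ T → ‖v t‖ ≤ B * (1 + ε)) {N : ℕ} (hN : N * Δt ≤ T) :
    ‖guidingCenter ε (xd N) (vd N) - guidingCenter ε (x (N * Δt)) (v (N * Δt))‖
        + ε * ‖vd N - v (N * Δt)‖ ≤
      Real.exp (2 * L * T) * T * (2 * L + 4 * (L * B) + M + 2 * B) * (Δt * (1 + (ε ^ 3)⁻¹)) := by
  have hM := hE.bdd_pos
  have hL := hE.lip_pos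
  have hT : 0 ≤ T := le_trans (by positivity) hN
  set p := ε⁻¹ with hp
  have hp0 : 0 < p := by positivity
  have hpe : p * ε = 1 := inv_mul_cancel₀ hε.ne'
  -- `b₁` bounds the variation of the field along one exact step. `b₂` adds `ε⁻¹` times that of the
  -- velocity, which is of order `Δt / ε²`; this is the source of `ε⁻³`.
  set b₁ := L * (Δt + p * (B * (1 + ε)) * Δt) with hb₁
  set b₂ := b₁ + p * ((p * M + p * p * (B * (1 + ε))) * Δt) with hb₂
  have hb₁0 : 0 ≤ b₁ := by positivity
  have hb₂0 : 0 ≤ b₂ := by positivity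
  -- The factor 2 arises because the field error enters both the guiding center and the velocity
  -- recursions.
  have key := le_exp_mul_of_succ_le (κ := 2 * L * Δt) (b := Δt * (b₁ + b₂)) (N := N)
    (a := fun n : ℕ => ‖guidingCenter ε (xd n) (vd n) -
      guidingCenter ε (x (n * Δt)) (v (n * Δt))‖ + ε * ‖vd n - v (n * Δt)‖)
    (by positivity) (by positivity) (by positivity) (by
      intro n hn
      have ht : (0 : ℝ) ≤ n * Δt := by positivity
      have hts : (n : ℝ) * Δt ≤ (n + 1 : ℕ) * Δt := by push_cast; linarith
      have htT := cast_mul_lt hΔ hN hn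
      have hdiff : ((n + 1 : ℕ) * Δt - n * Δt : ℝ) = Δt := by push_cast; ring
      have hvs : ∀ s, n * Δt ≤ s → s ≤ (n + 1 : ℕ) * Δt → ‖v s‖ ≤ B * (1 + ε) :=
        fun s h1 h2 => hv s (ht.trans h1) (h2.trans htT)
      set t := n * Δt
      set t' := (n + 1 : ℕ) * Δt
      have hxs : ∀ s, t ≤ s → s ≤ t' → ‖x s - x t‖ ≤ p * (B * (1 + ε)) * Δt := by
        intro s h1 h2
        refine (norm_sub_le_of_hasDerivWithinAt_Ici ht h1 h.deriv_x (C := p * (B * (1 + ε)))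
          fun r h3 h4 => ?_).trans ?_
        · rw [norm_smul, Real.norm_of_nonneg hp0.le]
          gcongr
          exact hvs r h3 (h4.trans h2)
        · gcongr; linarith
      have hEs : ∀ s, t ≤ s → s ≤ t' → ‖E s (x s) - E t (x t)‖ ≤ b₁ := by
        intro s h1 h2
        refine (hE.lip s t (ht.trans h1) ht _ _).trans ?_
        rw [abs_of_nonneg (sub_nonneg.2 h1)]
        have := hxs s h1 h2
        rw [hb₁]
        gcongr
        linarith
      have hvs' : ∀ s, t ≤ s → s ≤ t' → ‖v s - v t'‖ ≤ (p * M + p * p * (B * (1 + ε))) * Δt := by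
        intro s h1 h2
        rw [norm_sub_rev]
        refine (norm_sub_le_of_hasDerivWithinAt_Ici (ht.trans h1) h2 h.deriv_v
          (C := p * M + p * p * (B * (1 + ε))) fun r h3 h4 => ?_).trans ?_
        · rw [norm_smul, Real.norm_of_nonneg hp0.le, mul_assoc p p, ← mul_add]
          gcongr
          refine (norm_sub_le _ _).trans ?_
          rw [norm_smul, norm_perp, Real.norm_of_nonneg hp0.le]
          gcongr
          · exact hE.bdd r (by linarith) _
          · exact hvs r (h1.trans h3) h4
        · gcongr; linarith
      have s1 := h.guidingCenter_step hε ht hts (E t (x t)) hEs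
      have s2 := h.velocity_step hε ht hts (E t (x t)) (C := b₂) fun s h1 h2 => by
        have := hEs s h1 h2
        have := hvs' s h1 h2
        rw [hb₂]
        gcongr
      rw [hdiff] at s1 s2
      have hdx := norm_sub_le_guidingCenter hε (xd n) (vd n) (x t) (v t)
      set Y := guidingCenter ε (xd n) (vd n)
      set y := guidingCenter ε (x t) (v t)
      have hdE := hE.lip t t ht ht (xd n) (x t)
      rw [sub_self, abs_zero, zero_add] at hdE
      have hdE' : ‖E t (xd n) - E t (x t)‖ ≤ L * (‖Y - y‖ + ε * ‖vd n - v t‖) :=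
        hdE.trans (by gcongr)
      have r1 : ‖guidingCenter ε (xd (n + 1)) (vd (n + 1)) - guidingCenter ε (x t') (v t')‖ ≤
          ‖Y - y‖ + Δt * (L * (‖Y - y‖ + ε * ‖vd n - v t‖)) + b₁ * Δt := by
        rw [show guidingCenter ε (xd (n + 1)) (vd (n + 1)) - guidingCenter ε (x t') (v t') =
          (Y - y) + -(Δt • perp (E t (xd n) - E t (x t))) +
            -(guidingCenter ε (x t') (v t') - y + Δt • perp (E t (x t))) by
          rw [hd.guidingCenter_succ hε hΔ, perp_sub]; module]
        refine norm_add₃_le.trans ?_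
        rw [norm_neg, norm_neg, norm_smul, norm_perp, Real.norm_of_nonneg hΔ.le]
        gcongr
      have r2 : ε * ‖vd (n + 1) - v t'‖ ≤
          ε * ‖vd n - v t‖ + Δt * (L * (‖Y - y‖ + ε * ‖vd n - v t‖)) + b₂ * Δt := by
        -- The stiff term stays on the left, where it can only increase the norm; what remains on
        -- the right is not amplified.
        have e1 := norm_le_norm_add_smul_perp (Δt / ε ^ 2) (ε • (vd (n + 1) - v t'))
        rw [norm_smul, Real.norm_of_nonneg hε.le] at e1
        refine e1.trans ?_
        have e2 : ε • (vd (n + 1) - v t') + (Δt / ε ^ 2) • perp (ε • (vd (n + 1) - v t')) =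
          ε • (vd n - v t) + Δt • (E t (xd n) - E t (x t)) +
            -(ε • (v t' - v t) - Δt • E t (x t) + (Δt / ε) • perp (v t')) := by
          have e3 := hd.v_succ hε hΔ n
          rw [smul_sub, sub_eq_iff_eq_add] at e3
          rw [perp_smul, smul_smul, show Δt / ε ^ 2 * ε = Δt / ε by field_simp, smul_sub, e3,
            perp_sub]
          module
        rw [e2]
        refine norm_add₃_le.trans ?_
        rw [norm_neg, norm_smul ε, norm_smul Δt, Real.norm_of_nonneg hΔ.le,
          Real.norm_of_nonneg hε.le]
        gcongr
      linarith) N le_rfl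
  refine key.trans ?_
  have hzero : (fun n : ℕ => ‖guidingCenter ε (xd n) (vd n) -
      guidingCenter ε (x (n * Δt)) (v (n * Δt))‖ + ε * ‖vd n - v (n * Δt)‖) 0 = 0 := by
    simp [hd.init_x, hd.init_v, h.init_x, h.init_v]
  simp only at hzero
  rw [hzero, zero_add]
  have hb : b₁ + b₂ ≤ (2 * L + 4 * (L * B) + M + 2 * B) * (Δt * (1 + p ^ 3)) := by
    have e : b₁ + b₂ = Δt * (2 * L + 2 * (L * B) * (p + p * ε) + M * p ^ 2 +
      B * (p ^ 3 + p ^ 2 * (p * ε))) := by rw [hb₂, hb₁]; ring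
    rw [e, hpe]
    have q1 : p ≤ 1 + p ^ 3 := by nlinarith [mul_nonneg hp0.le (sq_nonneg (p - 1)), sq_nonneg (p-1)]
    have q2 : p ^ 2 ≤ 1 + p ^ 3 := by
      nlinarith [mul_nonneg hp0.le (sq_nonneg (p - 1)), sq_nonneg (p-1)]
    have q3 : 0 < p ^ 3 := by positivity
    have l1 : L * 1 ≤ L * (1 + p ^ 3) := by gcongr; linarith
    have l2 : L * B * (p + 1) ≤ L * B * (2 * (1 + p ^ 3)) := by gcongr; linarith
    have l3 : M * p ^ 2 ≤ M * (1 + p ^ 3) := by gcongr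
    have l4 : B * (p ^ 3 + p ^ 2 * 1) ≤ B * (2 * (1 + p ^ 3)) := by gcongr; linarith
    calc _ ≤ Δt * ((2 * L + 4 * (L * B) + M + 2 * B) * (1 + p ^ 3)) := by
          gcongr; linarith
      _ = _ := by ring
  calc Real.exp (N * (2 * L * Δt)) * (N * (Δt * (b₁ + b₂)))
      = Real.exp (2 * L * (N * Δt)) * ((N * Δt) * (b₁ + b₂)) := by ring_nf
    _ ≤ Real.exp (2 * L * T) * (T * ((2 * L + 4 * (L * B) + M + 2 * B) * (Δt * (1 + p ^ 3)))) := by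
        gcongr
    _ = _ := by rw [hp, inv_pow]; ring

/-- The error estimate by comparison with the guiding center dynamics, first order in `ε`. -/
theorem error_le_of_stiff_regime (hE : BddLip E M L) (hε : 0 < ε) (hΔ : 0 < Δt) (hB : 0 ≤ B)
    (h : IsCharacteristic E ε x₀ v₀ x v) (hd : IsImexScheme E ε Δt x₀ v₀ xd vd)
    (hv : ∀ t, 0 ≤ t → t ≤ T → ‖v t‖ ≤ B * (1 + ε))
    (hvd : ∀ n : ℕ, n * Δt ≤ T → ‖vd n‖ ≤ B * (1 + ε)) {N : ℕ} (hN : N * Δt ≤ T) :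
    ‖xd N - x (N * Δt)‖ ≤
      (Real.exp (L * T) * (T * L * (1 + M + 2 * B)) + 2 * B) * (Δt + ε * (1 + ε)) := by
  have hM := hE.bdd_pos
  have hL := hE.lip_pos
  have hT : 0 ≤ T := le_trans (by positivity) hN
  -- Velocity errors are not propagated here: they are bounded by the sum of the two velocities, at
  -- a cost of `2 B ε (1 + ε)`.
  set R := (1 + M) * Δt + 2 * B * (ε * (1 + ε)) with hR
  have hR0 : 0 ≤ R := by positivity
  have key := le_exp_mul_of_succ_le (κ := L * Δt) (b := Δt * (L * R)) (N := N)
    (a := fun n : ℕ => ‖guidingCenter ε (xd n) (vd n) -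
      guidingCenter ε (x (n * Δt)) (v (n * Δt))‖)
    (by positivity) (by positivity) (by positivity) (by
      intro n hn
      have ht : (0 : ℝ) ≤ n * Δt := by positivity
      have hts : (n : ℝ) * Δt ≤ (n + 1 : ℕ) * Δt := by push_cast; linarith
      have htT := cast_mul_lt hΔ hN hn
      have hdiff : ((n + 1 : ℕ) * Δt - n * Δt : ℝ) = Δt := by push_cast; ring
      have hvn := hvd n (cast_mul_lt hΔ hN hn.le)
      set t := n * Δt
      set t' := (n + 1 : ℕ) * Δt
      set Y := guidingCenter ε (xd n) (vd n) with hY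
      set y := guidingCenter ε (x t) (v t) with hy
      -- Comparing the exact step with the numerical field makes the two increments subtract
      -- directly.
      have s1 := h.guidingCenter_step hε ht hts (E t (xd n)) (C := L * (‖Y - y‖ + R)) fun s h1 h2 => by
        refine (hE.lip s t (ht.trans h1) ht _ _).trans ?_
        rw [abs_of_nonneg (sub_nonneg.2 h1)]
        have e1 := h.norm_guidingCenter_sub_le hE hε ht h1
        have e2 : M * (s - t) ≤ M * Δt := by gcongr; linarith
        have e3 : ‖v s - vd n‖ ≤ B * (1 + ε) + B * (1 + ε) :=
          (norm_sub_le _ _).trans (add_le_add (hv s (ht.trans h1) (h2.trans htT)) hvn)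
        have e4 := norm_sub_le_guidingCenter hε (x s) (v s) (xd n) (vd n)
        have e5 : ‖guidingCenter ε (x s) (v s) - Y‖ ≤
            ‖guidingCenter ε (x s) (v s) - y‖ + ‖Y - y‖ := by
          rw [norm_sub_rev Y y]; exact norm_sub_le_norm_sub_add_norm_sub _ _ _
        have e6 := mul_le_mul_of_nonneg_left e3 hε.le
        refine mul_le_mul_of_nonneg_left ?_ hL.le
        rw [hR]
        linarith
      rw [hdiff] at s1
      rw [show guidingCenter ε (xd (n + 1)) (vd (n + 1)) - guidingCenter ε (x t') (v t') =
          (Y - y) - (guidingCenter ε (x t') (v t') - y + Δt • perp (E t (xd n))) by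
          rw [hd.guidingCenter_succ hε hΔ]; module]
      refine (norm_sub_le _ _).trans ?_
      linarith) N le_rfl
  have hzero : (fun n : ℕ => ‖guidingCenter ε (xd n) (vd n) -
      guidingCenter ε (x (n * Δt)) (v (n * Δt))‖) 0 = 0 := by
    simp [hd.init_x, hd.init_v, h.init_x, h.init_v]
  simp only at hzero
  rw [hzero, zero_add] at key
  refine (norm_sub_le_guidingCenter hε (xd N) (vd N) _ (v (N * Δt))).trans ?_
  have e3 : ‖vd N - v (N * Δt)‖ ≤ B * (1 + ε) + B * (1 + ε) :=
    (norm_sub_le _ _).trans (add_le_add (hvd N hN) (hv _ (by positivity) hN))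
  have e6 := mul_le_mul_of_nonneg_left e3 hε.le
  have hRle : R ≤ (1 + M + 2 * B) * (Δt + ε * (1 + ε)) := by
    have : 0 ≤ (1 + M) * (ε * (1 + ε)) := by positivity
    have : 0 ≤ 2 * B * Δt := by positivity
    rw [hR]; linarith
  have e7 : Real.exp (N * (L * Δt)) * (N * (Δt * (L * R))) ≤
      Real.exp (L * T) * (T * (L * ((1 + M + 2 * B) * (Δt + ε * (1 + ε))))) := by
    rw [show N * (L * Δt) = L * (N * Δt) by ring,
      show N * (Δt * (L * R)) = (N * Δt) * (L * R) by ring]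
    gcongr
  have : 0 ≤ B * Δt := by positivity
  linarith

/-! ### Second order in `ε` -/

/-- `A` is an approximate derivative of `E` in position: it is bounded, Lipschitz continuous, and
gives the first order Taylor expansion of `E` up to a quadratic term and an error `δ`. -/
structure ApproxDeriv (E : ℝ → Plane → Plane) (A : ℝ → Plane → Plane →L[ℝ] Plane)
    (L K δ : ℝ) : Prop where
  bdd : ∀ t, 0 ≤ t → ∀ x h, ‖A t x h‖ ≤ L * ‖h‖
  taylor : ∀ t, 0 ≤ t → ∀ x h, ‖E t (x + h) - E t x - A t x h‖ ≤ K * ‖h‖ ^ 2 + δ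
  lip : ∀ s t, 0 ≤ s → 0 ≤ t → ∀ x y h, ‖A s x h - A t y h‖ ≤ K * (|s - t| + ‖x - y‖) * ‖h‖

variable {A : ℝ → Plane → Plane →L[ℝ] Plane} {K δ β : ℝ}

theorem ApproxDeriv.taylor_perp (hA : ApproxDeriv E A L K δ) (hε : 0 < ε) (hK : 0 ≤ K) {t : ℝ}
    (ht : 0 ≤ t) (x v : Plane) (hv : ‖v‖ ≤ β) :
    ‖E t x - E t (guidingCenter ε x v) - ε • A t (guidingCenter ε x v) (perp v)‖ ≤
      K * (ε ^ 2 * β ^ 2) + δ := by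
  have := hA.taylor t ht (guidingCenter ε x v) (ε • perp v)
  rw [guidingCenter_add, map_smul, norm_smul, norm_perp, Real.norm_of_nonneg hε.le, mul_pow] at this
  refine this.trans ?_
  gcongr

/-- With `A` frozen at time `a`, the term `ε³ A v'` equals `ε² A E - ε A (perp v)`. Subtracting `ε³
perp (A v)` thus removes the oscillating first order part of the field and leaves a remainder of
order `ε²`. -/
theorem IsCharacteristic.corrected_step (hE : BddLip E M L) (hA : ApproxDeriv E A L K δ)
    (hε : 0 < ε) (hK : 0 ≤ K) (hβ : 0 ≤ β) (h : IsCharacteristic E ε x₀ v₀ x v) {a b : ℝ}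
    (ha : 0 ≤ a) (hab : a ≤ b) (hv : ∀ s, a ≤ s → s ≤ b → ‖v s‖ ≤ β) :
    ‖guidingCenter ε (x b) (v b) - guidingCenter ε (x a) (v a)
        - ε ^ 3 • perp (A a (guidingCenter ε (x a) (v a)) (v b - v a))
        + (b - a) • perp (E a (guidingCenter ε (x a) (v a)))‖ ≤
      (K * (ε ^ 2 * β ^ 2) + δ + (1 + M) * (b - a) * (L + K * (ε * β)) + ε ^ 2 * (L * M))
        * (b - a) := by
  have hM := hE.bdd_pos
  have hL := hE.lip_pos
  set y := fun s => guidingCenter ε (x s) (v s) with hy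
  set A₀ := A a (y a)
  have := norm_sub_le_of_hasDerivWithinAt_Ici
    (C := K * (ε ^ 2 * β ^ 2) + δ + (1 + M) * (b - a) * (L + K * (ε * β)) + ε ^ 2 * (L * M))
    (f := fun s => y s - ε ^ 3 • perpL (A₀ (v s)) + s • perp (E a (y a)))
    (f' := fun s => -perp (E s (x s)) -
      ε ^ 3 • perpL (A₀ (ε⁻¹ • (E s (x s) - ε⁻¹ • perp (v s)))) + (1 : ℝ) • perp (E a (y a)))
    ha hab
    (fun s hs => ((h.hasDerivWithinAt_guidingCenter hε hs).sub
      (((perpL.comp A₀).hasFDerivAt.comp_hasDerivWithinAt s (h.deriv_v s hs)).const_smul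
        (ε ^ 3))).add ((hasDerivWithinAt_id s _).smul_const _))
    (fun s hs hs' => by
      have hs0 := ha.trans hs
      have e1 : -perp (E s (x s)) -
          ε ^ 3 • perpL (A₀ (ε⁻¹ • (E s (x s) - ε⁻¹ • perp (v s)))) + (1 : ℝ) • perp (E a (y a)) =
          -perp ((E s (x s) - E s (y s) - ε • A s (y s) (perp (v s))) + (E s (y s) - E a (y a)) +
            (ε • (A s (y s) (perp (v s)) - A₀ (perp (v s))) + ε ^ 2 • A₀ (E s (x s)))) := by
        have c1 : ε ^ 3 * ε⁻¹ = ε ^ 2 := by field_simp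
        have c2 : ε ^ 2 * ε⁻¹ = ε := by field_simp
        simp only [map_smul, map_sub, perpL_apply, perp_add, perp_sub, perp_smul, smul_sub,
          smul_smul, ← mul_assoc, c1, c2]
        module
      rw [e1, norm_neg, norm_perp]
      refine norm_add₃_le.trans ?_
      have d1 := hA.taylor_perp hε hK hs0 (x s) (v s) (hv s hs hs')
      have d0 := h.norm_guidingCenter_sub_le hE hε ha hs
      have d0' : |s - a| + ‖y s - y a‖ ≤ (1 + M) * (b - a) := by
        rw [abs_of_nonneg (sub_nonneg.2 hs)]
        have : M * (s - a) ≤ M * (b - a) := by gcongr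
        linarith
      have d2 : ‖E s (y s) - E a (y a)‖ ≤ L * ((1 + M) * (b - a)) :=
        (hE.lip s a hs0 ha _ _).trans (by gcongr)
      have d3 : ‖A s (y s) (perp (v s)) - A₀ (perp (v s))‖ ≤ K * ((1 + M) * (b - a)) * β := by
        refine (hA.lip s a hs0 ha _ _ _).trans ?_
        rw [norm_perp]
        have := hv s hs hs'
        have : 0 ≤ (1 + M) * (b - a) := le_trans (by positivity) d0'
        gcongr
      have d4 : ‖A₀ (E s (x s))‖ ≤ L * M := by
        refine (hA.bdd a ha _ _).trans ?_
        gcongr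
        exact hE.bdd s hs0 _
      have d5 : ‖ε • (A s (y s) (perp (v s)) - A₀ (perp (v s))) + ε ^ 2 • A₀ (E s (x s))‖ ≤
          ε * (K * ((1 + M) * (b - a)) * β) + ε ^ 2 * (L * M) := by
        refine (norm_add_le _ _).trans ?_
        rw [norm_smul, norm_smul, Real.norm_of_nonneg hε.le, Real.norm_of_nonneg (sq_nonneg ε)]
        gcongr
      linarith)
  refine (le_of_eq ?_).trans this
  congr 1
  simp only [hy, map_sub, perpL_apply, perp_sub]
  module

/-- The discrete counterpart: `ε³ (v (n+1) - v n)` equals `ε² Δt E - ε Δt perp (v (n+1))`. The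
increment that compensates the step leaving index `n + 1` is the velocity increment arriving there,
hence the shift of indices. -/
theorem IsImexScheme.corrected_step (hE : BddLip E M L) (hA : ApproxDeriv E A L K δ)
    (hε : 0 < ε) (hΔ : 0 < Δt) (hK : 0 ≤ K) (hd : IsImexScheme E ε Δt x₀ v₀ xd vd) {n : ℕ}
    (hv : ‖vd (n + 1)‖ ≤ β) :
    ‖guidingCenter ε (xd (n + 2)) (vd (n + 2)) - guidingCenter ε (xd (n + 1)) (vd (n + 1))
        - ε ^ 3 • perp (A ((n + 1 : ℕ) * Δt) (guidingCenter ε (xd (n + 1)) (vd (n + 1)))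
            (vd (n + 1) - vd n))
        + Δt • perp (E ((n + 1 : ℕ) * Δt) (guidingCenter ε (xd (n + 1)) (vd (n + 1))))‖ ≤
      (K * (ε ^ 2 * β ^ 2) + δ + ε ^ 2 * (L * M)) * Δt := by
  have hL := hE.lip_pos
  have hM := hE.bdd_pos
  have ht : (0 : ℝ) ≤ (n + 1 : ℕ) * Δt := by positivity
  have hn : (0 : ℝ) ≤ n * Δt := by positivity
  have d1 := hA.taylor_perp hε hK ht (xd (n + 1)) (vd (n + 1)) hv
  rw [hd.guidingCenter_succ hε hΔ (n + 1)]
  set t := (n + 1 : ℕ) * Δt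
  set Y := guidingCenter ε (xd (n + 1)) (vd (n + 1))
  have e1 : ε ^ 3 • (vd (n + 1) - vd n) =
      (ε ^ 2 * Δt) • E (n * Δt) (xd n) - (ε * Δt) • perp (vd (n + 1)) := by
    rw [show ε ^ 3 = ε ^ 2 * ε by ring, mul_smul, hd.v_succ hε hΔ n, smul_sub, smul_smul,
      smul_smul, show ε ^ 2 * (Δt / ε) = ε * Δt by field_simp]
  have e2 : ε ^ 3 • perp (A t Y (vd (n + 1) - vd n)) =
      perp ((ε ^ 2 * Δt) • A t Y (E (n * Δt) (xd n)) - (ε * Δt) • A t Y (perp (vd (n + 1)))) := by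
    rw [← perp_smul, ← map_smul, e1, map_sub, map_smul, map_smul]
  rw [e2, show Y - Δt • perp (E t (xd (n + 1))) - Y - perp ((ε ^ 2 * Δt) • A t Y (E (n * Δt) (xd n))
      - (ε * Δt) • A t Y (perp (vd (n + 1)))) + Δt • perp (E t Y) =
    (-Δt) • perp ((E t (xd (n + 1)) - E t Y - ε • A t Y (perp (vd (n + 1)))) +
      ε ^ 2 • A t Y (E (n * Δt) (xd n))) by
    simp only [perp_add, perp_sub, perp_smul]; module]
  rw [norm_smul, norm_perp, norm_neg, Real.norm_of_nonneg hΔ.le, mul_comm]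
  gcongr
  refine (norm_add_le _ _).trans ?_
  gcongr
  rw [norm_smul, Real.norm_of_nonneg (sq_nonneg ε)]
  gcongr
  refine (hA.bdd t ht _ _).trans ?_
  gcongr
  exact hE.bdd _ hn _

/-- Summation by parts: moving `A` from the old point to the new one costs only `ε³ ‖u'‖` times the
Lipschitz variation of `A` over a step, and turns the correction into a telescoping difference. -/
theorem corrected_step_shift (hA : ApproxDeriv E A L K δ) (hε : 0 < ε) (hΔ : 0 < Δt)
    (hK : 0 ≤ K) (hM : 0 ≤ M) {R t t' : ℝ} (ht : 0 ≤ t) (ht' : t' = t + Δt) {Y Y' u u' : Plane}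
    (hu : ‖u'‖ ≤ β) (hY : ‖Y' - Y‖ ≤ M * Δt)
    (h : ‖Y' - Y - ε ^ 3 • perp (A t Y (u' - u)) + Δt • perp (E t Y)‖ ≤ R * Δt) :
    ‖(Y' - ε ^ 3 • perp (A t' Y' u')) - (Y - ε ^ 3 • perp (A t Y u)) + Δt • perp (E t Y)‖ ≤
      (R + K * (1 + M) * (ε ^ 3 * β)) * Δt := by
  have e : (Y' - ε ^ 3 • perp (A t' Y' u')) - (Y - ε ^ 3 • perp (A t Y u)) + Δt • perp (E t Y) =
      (Y' - Y - ε ^ 3 • perp (A t Y (u' - u)) + Δt • perp (E t Y)) -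
        ε ^ 3 • perp (A t' Y' u' - A t Y u') := by
    rw [map_sub]; simp only [perp_sub]; module
  rw [e]
  refine (norm_sub_le _ _).trans ?_
  rw [norm_smul, norm_perp, Real.norm_of_nonneg (by positivity)]
  have h1 := hA.lip t' t (by linarith) ht Y' Y u'
  rw [ht', add_sub_cancel_left, abs_of_pos hΔ] at h1
  have h2 : ‖A (t + Δt) Y' u' - A t Y u'‖ ≤ K * (Δt + M * Δt) * β := h1.trans (by gcongr)
  have h3 := mul_le_mul_of_nonneg_left h2 (by positivity : 0 ≤ ε ^ 3)
  rw [ht']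
  linarith

/-- Two approximate solutions of the guiding center scheme, both corrected at order `ε³`, stay
close to each other. -/
theorem norm_sub_le_of_corrected_step (hE : BddLip E M L) (hA : ApproxDeriv E A L K δ)
    (hε : 0 < ε) (hΔ : 0 < Δt) (hβ : 0 ≤ β) {R : ℝ} (hR : 0 ≤ R)
    {τ : ℕ → ℝ} (hτ : ∀ n, 0 ≤ τ n) {Y u Y' u' : ℕ → Plane} {N : ℕ}
    (hu : ∀ n ≤ N, ‖u n‖ ≤ β) (hu' : ∀ n ≤ N, ‖u' n‖ ≤ β)
    (h : ∀ n < N, ‖(Y (n + 1) - ε ^ 3 • perp (A (τ (n + 1)) (Y (n + 1)) (u (n + 1)))) -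
      (Y n - ε ^ 3 • perp (A (τ n) (Y n) (u n))) + Δt • perp (E (τ n) (Y n))‖ ≤ R * Δt)
    (h' : ∀ n < N, ‖(Y' (n + 1) - ε ^ 3 • perp (A (τ (n + 1)) (Y' (n + 1)) (u' (n + 1)))) -
      (Y' n - ε ^ 3 • perp (A (τ n) (Y' n) (u' n))) + Δt • perp (E (τ n) (Y' n))‖ ≤ R * Δt) :
    ‖Y N - Y' N‖ ≤ Real.exp (L * (N * Δt)) * (‖Y 0 - Y' 0‖ + 2 * L * (ε ^ 3 * β) +
      N * Δt * (2 * L ^ 2 * (ε ^ 3 * β) + 2 * R)) + 2 * L * (ε ^ 3 * β) := by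
  have hL := hE.lip_pos
  set Z := fun n => Y n - ε ^ 3 • perp (A (τ n) (Y n) (u n)) with hZ
  set Z' := fun n => Y' n - ε ^ 3 • perp (A (τ n) (Y' n) (u' n)) with hZ'
  have hc : ∀ n y w, ‖w‖ ≤ β → ‖ε ^ 3 • perp (A (τ n) y w)‖ ≤ L * (ε ^ 3 * β) := by
    intro n y w hw
    rw [norm_smul, norm_perp, Real.norm_of_nonneg (by positivity)]
    calc ε ^ 3 * ‖A (τ n) y w‖ ≤ ε ^ 3 * (L * β) := by
          gcongr; exact (hA.bdd _ (hτ n) _ _).trans (by gcongr)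
      _ = _ := by ring
  have hYZ : ∀ n ≤ N, ‖Y n - Y' n‖ ≤ ‖Z n - Z' n‖ + 2 * L * (ε ^ 3 * β) := by
    intro n hn
    rw [show Y n - Y' n = (Z n - Z' n) + ε ^ 3 • perp (A (τ n) (Y n) (u n)) +
      -(ε ^ 3 • perp (A (τ n) (Y' n) (u' n))) by simp only [hZ, hZ']; module]
    refine norm_add₃_le.trans ?_
    rw [norm_neg]
    linarith [hc n (Y n) _ (hu n hn), hc n (Y' n) _ (hu' n hn)]
  have hZY : ‖Z 0 - Z' 0‖ ≤ ‖Y 0 - Y' 0‖ + 2 * L * (ε ^ 3 * β) := by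
    rw [show Z 0 - Z' 0 = (Y 0 - Y' 0) + -(ε ^ 3 • perp (A (τ 0) (Y 0) (u 0))) +
      (ε ^ 3 • perp (A (τ 0) (Y' 0) (u' 0))) by simp only [hZ, hZ']; module]
    refine norm_add₃_le.trans ?_
    rw [norm_neg]
    linarith [hc 0 (Y 0) _ (hu 0 (by omega)), hc 0 (Y' 0) _ (hu' 0 (by omega))]
  -- Grönwall is applied to the corrected variables `Z`, while the field is evaluated at `Y`;
  -- passing between them costs `2 L ε³ β` at each use.
  have key := le_exp_mul_of_succ_le (a := fun n => ‖Z n - Z' n‖) (κ := L * Δt)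
    (b := Δt * (2 * L ^ 2 * (ε ^ 3 * β) + 2 * R)) (N := N) (by positivity) (by positivity)
    (norm_nonneg _) (by
      intro n hn
      have s1 := h n hn
      have s2 := h' n hn
      have s3 := hE.lip (τ n) (τ n) (hτ n) (hτ n) (Y n) (Y' n)
      rw [sub_self, abs_zero, zero_add] at s3
      have s4 := s3.trans (mul_le_mul_of_nonneg_left (hYZ n hn.le) hL.le)
      rw [show Z (n + 1) - Z' (n + 1) = (Z n - Z' n) +
        ((Z (n + 1) - Z n + Δt • perp (E (τ n) (Y n))) -
          (Z' (n + 1) - Z' n + Δt • perp (E (τ n) (Y' n)))) +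
        -(Δt • perp (E (τ n) (Y n) - E (τ n) (Y' n))) by rw [perp_sub]; module]
      refine norm_add₃_le.trans ?_
      rw [norm_neg, norm_smul, norm_perp, Real.norm_of_nonneg hΔ.le]
      have s5 := norm_sub_le (Z (n + 1) - Z n + Δt • perp (E (τ n) (Y n)))
          (Z' (n + 1) - Z' n + Δt • perp (E (τ n) (Y' n)))
      have s6 := mul_le_mul_of_nonneg_left s4 hΔ.le
      linarith) N le_rfl
  refine (hYZ N le_rfl).trans ?_
  gcongr
  refine key.trans ?_
  rw [show N * (L * Δt) = L * (N * Δt) by ring, ← mul_assoc (N : ℝ) Δt]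
  gcongr

set_option maxHeartbeats 800000 in
/-- The error estimate by comparison with the guiding center dynamics, second order in `ε`. -/
theorem guidingCenter_error_le (hE : BddLip E M L) (hA : ApproxDeriv E A L K Δt)
    (hε : 0 < ε) (hΔ : 0 < Δt) (hK : 0 ≤ K) (hB : 0 ≤ B)
    (h : IsCharacteristic E ε x₀ v₀ x v) (hd : IsImexScheme E ε Δt x₀ v₀ xd vd)
    (hv : ∀ t, 0 ≤ t → t ≤ T → ‖v t‖ ≤ B * (1 + ε))
    (hvd : ∀ n : ℕ, n * Δt ≤ T → ‖vd n‖ ≤ B * (1 + ε)) {N : ℕ} (hN : (N + 1 : ℕ) * Δt ≤ T) :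
    ‖guidingCenter ε (xd (N + 1)) (vd (N + 1)) -
        guidingCenter ε (x ((N + 1 : ℕ) * Δt)) (v ((N + 1 : ℕ) * Δt))‖ ≤
      (Real.exp (L * T) * (2 * M + 4 * L * B + T * (4 * L ^ 2 * B + 2 * (2 * K * B ^ 2 + 1 +
        (1 + M) * (L + 2 * K * B) + L * M + 2 * K * (1 + M) * B))) + 4 * L * B) *
        ((Δt + ε ^ 2) * (1 + ε ^ 2)) := by
  have hM := hE.bdd_pos
  have hL := hE.lip_pos
  have hT : 0 ≤ T := le_trans (by positivity) hN
  set β := B * (1 + ε) with hβ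
  have hβ0 : 0 ≤ β := by positivity
  set S := (Δt + ε ^ 2) * (1 + ε ^ 2) with hS
  have hS0 : 0 ≤ S := by positivity
  set R₀ := K * (ε ^ 2 * β ^ 2) + Δt + (1 + M) * Δt * (L + K * (ε * β)) + ε ^ 2 * (L * M) with hR₀
  set R := R₀ + K * (1 + M) * (ε ^ 3 * β) with hR
  have hR0 : 0 ≤ R := by positivity
  have hnT : ∀ n ≤ N, ((n + 1 : ℕ) : ℝ) * Δt ≤ T := fun n hn => cast_mul_lt hΔ hN (by omega)
  -- The sequences start at `t₁`: the numerical guiding center at index `n + 1` is corrected with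
  -- `vd n`, the exact one with the velocity at the same time.
  have key := norm_sub_le_of_corrected_step hE hA hε hΔ hβ0 hR0 (τ := fun n => (n + 1 : ℕ) * Δt)
    (fun n => by positivity) (N := N)
    (Y := fun n => guidingCenter ε (xd (n + 1)) (vd (n + 1))) (u := vd)
    (Y' := fun n => guidingCenter ε (x ((n + 1 : ℕ) * Δt)) (v ((n + 1 : ℕ) * Δt)))
    (u' := fun n => v ((n + 1 : ℕ) * Δt))
    (fun n hn => hvd n (cast_mul_lt hΔ hN (by omega)))
    (fun n hn => hv _ (by positivity) (hnT n hn))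
    (fun n hn => corrected_step_shift hA hε hΔ hK hM.le (by positivity) (by push_cast; ring)
      (hvd (n + 1) (hnT n hn.le))
      (by
        rw [hd.guidingCenter_succ hε hΔ (n + 1), sub_sub_cancel_left, norm_neg, norm_smul,
          norm_perp, Real.norm_of_nonneg hΔ.le, mul_comm]
        gcongr
        exact hE.bdd _ (by positivity) _)
      ((hd.corrected_step hE hA hε hΔ hK (hvd (n + 1) (hnT n hn.le))).trans (by
        gcongr
        have : 0 ≤ (1 + M) * Δt * (L + K * (ε * β)) := by positivity
        rw [hR₀]; linarith)))
    (fun n hn => by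
      have hdiff : ((n + 1 + 1 : ℕ) * Δt - (n + 1 : ℕ) * Δt : ℝ) = Δt := by push_cast; ring
      have ht : (0 : ℝ) ≤ (n + 1 : ℕ) * Δt := by positivity
      have hle : ((n + 1 : ℕ) : ℝ) * Δt ≤ (n + 1 + 1 : ℕ) * Δt := by linarith
      refine corrected_step_shift hA hε hΔ hK hM.le ht (by push_cast; ring)
        (hv _ (by positivity) (hnT (n + 1) hn)) ?_ ?_
      · have := h.norm_guidingCenter_sub_le hE hε ht hle
        rwa [hdiff] at this
      · have := h.corrected_step hE hA hε hK hβ0 ht hle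
          (fun s h1 h2 => hv s (ht.trans h1) (h2.trans (hnT (n + 1) hn)))
        rwa [hdiff] at this)
  refine key.trans ?_
  -- The first step is outside the recursion; both guiding centers start from the same point and
  -- move by at most `M * Δt`.
  have hY0 : ‖guidingCenter ε (xd (0 + 1)) (vd (0 + 1)) -
      guidingCenter ε (x ((0 + 1 : ℕ) * Δt)) (v ((0 + 1 : ℕ) * Δt))‖ ≤ 2 * M * Δt := by
    have h1 := h.norm_guidingCenter_sub_le hE hε le_rfl hΔ.le
    rw [hd.guidingCenter_succ hε hΔ 0, hd.init_x, hd.init_v]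
    rw [h.init_x, h.init_v] at h1
    rw [show guidingCenter ε x₀ v₀ - Δt • perp (E ((0 : ℕ) * Δt) x₀) -
      guidingCenter ε (x ((0 + 1 : ℕ) * Δt)) (v ((0 + 1 : ℕ) * Δt)) =
      -(Δt • perp (E ((0 : ℕ) * Δt) x₀)) - (guidingCenter ε (x Δt) (v Δt) - guidingCenter ε x₀ v₀) by
        simp only [zero_add, Nat.cast_one, one_mul]; module]
    refine (norm_sub_le _ _).trans ?_
    rw [norm_neg, norm_smul, norm_perp, Real.norm_of_nonneg hΔ.le]
    have h2 : Δt * ‖E ((0 : ℕ) * Δt) x₀‖ ≤ Δt * M := by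
      gcongr; exact hE.bdd _ (by simp) _
    linarith
  have q0 : ε ≤ 1 + ε ^ 2 := by nlinarith [sq_nonneg (ε - 1)]
  have q1 : ε ^ 3 * β ≤ 2 * B * S := by
    calc ε ^ 3 * β = B * (ε ^ 2 * (ε + ε ^ 2)) := by rw [hβ]; ring
      _ ≤ B * ((Δt + ε ^ 2) * (2 * (1 + ε ^ 2))) := by gcongr <;> linarith
      _ = _ := by ring
  have q2 : ε ^ 2 * β ^ 2 ≤ 2 * B ^ 2 * S := by
    calc ε ^ 2 * β ^ 2 = B ^ 2 * (ε ^ 2 * (1 + ε) ^ 2) := by rw [hβ]; ring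
      _ ≤ B ^ 2 * ((Δt + ε ^ 2) * (2 * (1 + ε ^ 2))) := by
          gcongr
          · linarith
          · nlinarith [sq_nonneg (ε - 1)]
      _ = _ := by ring
  have q3 : Δt * (ε * β) ≤ 2 * B * S := by
    calc Δt * (ε * β) = B * (Δt * (ε + ε ^ 2)) := by rw [hβ]; ring
      _ ≤ B * ((Δt + ε ^ 2) * (2 * (1 + ε ^ 2))) := by
          gcongr
          · linarith [sq_nonneg ε]
          · linarith
      _ = _ := by ring
  have q4 : Δt + ε ^ 2 ≤ S := by
    rw [hS]; exact le_mul_of_one_le_right (by positivity) (by linarith [sq_nonneg ε])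
  have q5 : Δt ≤ S := by linarith [sq_nonneg ε]
  have q6 : ε ^ 2 ≤ S := by linarith
  have hRS : R ≤ (2 * K * B ^ 2 + 1 + (1 + M) * (L + 2 * K * B) + L * M +
      2 * K * (1 + M) * B) * S := by
    calc R = K * (ε ^ 2 * β ^ 2) + Δt + ((1 + M) * L * Δt + (1 + M) * K * (Δt * (ε * β)))
          + (L * M) * ε ^ 2 + K * (1 + M) * (ε ^ 3 * β) := by rw [hR, hR₀]; ring
      _ ≤ K * (2 * B ^ 2 * S) + S + ((1 + M) * L * S + (1 + M) * K * (2 * B * S))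
          + (L * M) * S + K * (1 + M) * (2 * B * S) := by gcongr
      _ = _ := by ring
  set Q := 2 * K * B ^ 2 + 1 + (1 + M) * (L + 2 * K * B) + L * M + 2 * K * (1 + M) * B
  have hNT : N * Δt ≤ T := cast_mul_lt hΔ hN (by omega)
  calc _ ≤ Real.exp (L * T) * (2 * M * S + 2 * L * (2 * B * S) +
        T * (2 * L ^ 2 * (2 * B * S) + 2 * (Q * S))) + 2 * L * (2 * B * S) := by
        have : 2 * M * Δt ≤ 2 * M * S := by gcongr
        have hY1 := hY0.trans this
        gcongr
    _ = _ := by ring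

end Errors

/-! ### Mollification of Sobolev functions -/

theorem locallyIntegrable_indicator_of_memLp_top {X F : Type*} [NormedAddCommGroup X] [NormedSpace ℝ X]
    [MeasureSpace X] [FiniteDimensional ℝ X] [(volume : Measure X).IsAddHaarMeasure]
    [NormedAddCommGroup F] {Ω : Set X} (hΩ : MeasurableSet Ω) {f : X → F}
    (hf : MemLp f ⊤ (volume.restrict Ω)) : LocallyIntegrable (Ω.indicator f) :=
  ((memLp_indicator_iff_restrict hΩ).2 hf).locallyIntegrable le_top

theorem exists_ae_bound {X F : Type*} [MeasureSpace X] [NormedAddCommGroup F] {Ω : Set X}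
    {f : X → F} (hf : MemLp f ⊤ (volume.restrict Ω)) :
    ∃ G : ℝ, 0 ≤ G ∧ ∀ᵐ z ∂(volume.restrict Ω), ‖f z‖ ≤ G :=
  ⟨_, ENNReal.toReal_nonneg, by
    have h := ae_le_eLpNormEssSup (f := f) (μ := volume.restrict Ω)
    filter_upwards [h] with z hz
    have hfin : eLpNormEssSup f (volume.restrict Ω) ≠ ⊤ := by
      have := hf.2.ne
      rwa [eLpNorm_exponent_top] at this
    have := ENNReal.toReal_mono hfin hz
    simpa using this⟩

theorem MemWkInfty.of_succ {X F : Type*} [NormedAddCommGroup X] [NormedSpace ℝ X] [MeasureSpace X]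
    [NormedAddCommGroup F] [NormedSpace ℝ F] {Ω : Set X} {f : X → F} : ∀ {k : ℕ}, MemWkInfty Ω (k + 1) f → MemWkInfty Ω k f := by
  intro k
  induction k generalizing f with
  | zero => exact fun h => h.1
  | succ k ih => exact fun h => ⟨h.1, fun e =>
      let ⟨g, hg, hgm⟩ := h.2 e
      ⟨g, hg, ih hgm⟩⟩

section Mollify

open ContinuousLinearMap Convolution

variable {X F : Type*} [NormedAddCommGroup X] [NormedSpace ℝ X] [MeasureSpace X] [BorelSpace X]
  [FiniteDimensional ℝ X] [(volume : Measure X).IsAddHaarMeasure]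
  [NormedAddCommGroup F] [NormedSpace ℝ F] {Ω : Set X}

/-- The mollification of `f`, extended by zero outside `Ω`. -/
noncomputable def mollify (Ω : Set X) (φ : ContDiffBump (0 : X)) (f : X → F) : X → F :=
  (φ.normed volume) ⋆[lsmul ℝ ℝ, volume] (Ω.indicator f)

theorem mollify_apply (φ : ContDiffBump (0 : X)) (f : X → F) (z : X) :
    mollify Ω φ f z = ∫ w, φ.normed volume (z - w) • Ω.indicator f w :=
  convolution_lsmul_swap

theorem norm_mollify_le (hΩ : MeasurableSet Ω) (φ : ContDiffBump (0 : X)) {f : X → F} {G : ℝ}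
    (hG : 0 ≤ G) (hf : ∀ᵐ z ∂(volume.restrict Ω), ‖f z‖ ≤ G) (z : X) :
    ‖mollify Ω φ f z‖ ≤ G := by
  rw [mollify_apply]
  have hint : Integrable (fun w => φ.normed volume (z - w) * G) :=
    ((φ.integrable_normed (μ := volume)).comp_sub_left z).mul_const G
  refine (norm_integral_le_of_norm_le hint ?_).trans ?_
  · rw [ae_restrict_iff' hΩ] at hf
    filter_upwards [hf] with w hw
    rw [norm_smul, Real.norm_of_nonneg (φ.nonneg_normed _)]
    gcongr
    · exact φ.nonneg_normed _
    · by_cases h : w ∈ Ω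
      · rw [indicator_of_mem h]; exact hw h
      · rw [indicator_of_notMem h, norm_zero]; exact hG
  · rw [integral_mul_const, integral_sub_left_eq_self (fun w => φ.normed volume w) volume z,
      φ.integral_normed, one_mul]

theorem hasFDerivAt_mollify (hΩ : MeasurableSet Ω) (φ : ContDiffBump (0 : X)) {f : X → F}
    (hf : MemLp f ⊤ (volume.restrict Ω)) (z : X) :
    HasFDerivAt (mollify Ω φ f) ((fderiv ℝ (φ.normed volume) ⋆[(lsmul ℝ ℝ).precompL X, volume]
      Ω.indicator f) z) z :=
  φ.hasCompactSupport_normed.hasFDerivAt_convolution_left (lsmul ℝ ℝ) φ.contDiff_normed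
    (locallyIntegrable_indicator_of_memLp_top hΩ hf) z

/-- The reflected kernel `w ↦ ρ (z - w)` is an admissible test function exactly because the closed
ball lies in `Ω`, so the extension by zero creates no boundary term. -/
theorem fderiv_mollify_apply (hΩ : MeasurableSet Ω) (φ : ContDiffBump (0 : X)) {f g : X → F}
    (hf : MemLp f ⊤ (volume.restrict Ω)) {e : X} (hg : HasWeakDeriv Ω f g e) {z : X}
    (hz : Metric.closedBall z φ.rOut ⊆ Ω) :
    fderiv ℝ (mollify Ω φ f) z e = mollify Ω φ g z := by
  set ρ := φ.normed (volume : Measure X) with hρ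
  have hρd : ContDiff ℝ ∞ ρ := φ.contDiff_normed
  have hρs : HasCompactSupport ρ := φ.hasCompactSupport_normed
  rw [(hasFDerivAt_mollify hΩ φ hf z).fderiv, mollify_apply]
  have hex : ConvolutionExistsAt (fderiv ℝ ρ) (Ω.indicator f) z ((lsmul ℝ ℝ).precompL X) volume :=
    HasCompactSupport.convolutionExists_left _ (hρs.fderiv (𝕜 := ℝ))
      (hρd.continuous_fderiv (by simp)) (locallyIntegrable_indicator_of_memLp_top hΩ hf) z
  set ψ : X → ℝ := fun w => ρ (z - w) with hψ
  have hψd : ContDiff ℝ ∞ ψ := hρd.comp (contDiff_const.sub contDiff_id)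
  have hsupp : Function.support ψ ⊆ Metric.ball z φ.rOut := by
    intro w hw
    have : z - w ∈ Function.support ρ := hw
    rw [hρ, φ.support_normed_eq, mem_ball_zero_iff] at this
    rwa [mem_ball_iff_norm']
  have htsupp : tsupport ψ ⊆ Metric.closedBall z φ.rOut :=
    closure_minimal (hsupp.trans Metric.ball_subset_closedBall) Metric.isClosed_closedBall
  have hψs : HasCompactSupport ψ :=
    HasCompactSupport.of_support_subset_isCompact (isCompact_closedBall z φ.rOut)
      (hsupp.trans Metric.ball_subset_closedBall)
  have hψf : ∀ w, fderiv ℝ ψ w e = -(fderiv ℝ ρ (z - w) e) := by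
    intro w
    have h1 : HasFDerivAt ρ (fderiv ℝ ρ (z - w)) (z - w) :=
      (hρd.differentiable (by simp)).differentiableAt.hasFDerivAt
    have h2 := h1.comp w ((hasFDerivAt_id w).const_sub z)
    rw [show ψ = ρ ∘ fun w => z - w from rfl, HasFDerivAt.fderiv h2]
    simp
  have hw := hg ψ hψd hψs (htsupp.trans hz)
  have hzero : ∀ w, w ∉ Ω → ψ w = 0 ∧ fderiv ℝ ψ w e = 0 := by
    intro w hwΩ
    have : w ∉ tsupport ψ := fun h => hwΩ (hz (htsupp h))
    exact ⟨image_eq_zero_of_notMem_tsupport this, by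
      rw [image_eq_zero_of_notMem_tsupport fun h => this (tsupport_fderiv_subset ℝ h)]; simp⟩
  have hi1 : ∀ w, fderiv ℝ ψ w e • f w = -(fderiv ℝ ρ (z - w) e • Ω.indicator f w) := by
    intro w
    by_cases h : w ∈ Ω
    · rw [indicator_of_mem h, hψf, neg_smul]
    · rw [(hzero w h).2, indicator_of_notMem h]; simp
  have hi2 : ∀ w, ψ w • g w = ρ (z - w) • Ω.indicator g w := by
    intro w
    by_cases h : w ∈ Ω
    · rw [indicator_of_mem h]
    · rw [(hzero w h).1, indicator_of_notMem h]; simp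
  simp only [hi1, hi2, integral_neg, neg_inj] at hw
  rw [← hw, convolution_def, ContinuousLinearMap.integral_apply hex]
  simp only [precompL_apply, lsmul_apply]
  rw [← integral_sub_left_eq_self _ volume z]
  simp

/-- The weak derivatives are bounded one direction at a time, without uniformity in the direction; a
finite basis supplies an operator norm bound. It is essential that `K` does not depend on the
mollifier. -/
theorem exists_norm_fderiv_mollify_le (hΩ : MeasurableSet Ω) {f : X → F}
    (hf : MemWkInfty Ω 1 f) : ∃ K : ℝ, 0 ≤ K ∧ ∀ (φ : ContDiffBump (0 : X)) (z : X),
      Metric.closedBall z φ.rOut ⊆ Ω → ‖fderiv ℝ (mollify Ω φ f) z‖ ≤ K := by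
  choose g hg hgm using hf.2
  choose G hG0 hG using fun e => exists_ae_bound (hgm e)
  let b := Module.finBasis ℝ X
  obtain ⟨C, hC, hb⟩ := b.exists_opNorm_le (F := F)
  refine ⟨C * ∑ i, G (b i), mul_nonneg hC.le (Finset.sum_nonneg fun i _ => hG0 _),
    fun φ z hz => hb (Finset.sum_nonneg fun i _ => hG0 _) fun i => ?_⟩
  rw [fderiv_mollify_apply hΩ φ hf.1 (hg (b i)) hz]
  exact (norm_mollify_le hΩ φ (hG0 _) (hG _) z).trans
    (Finset.single_le_sum (f := fun i => G (b i)) (fun i _ => hG0 _) (Finset.mem_univ i))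

theorem exists_norm_mollify_sub_le (hΩ : MeasurableSet Ω) {f : X → F}
    (hf : MemWkInfty Ω 1 f) : ∃ K : ℝ, 0 ≤ K ∧ ∀ (φ : ContDiffBump (0 : X)) (S : Set X),
      Convex ℝ S → (∀ z ∈ S, Metric.closedBall z φ.rOut ⊆ Ω) → ∀ z ∈ S, ∀ z' ∈ S,
      ‖mollify Ω φ f z - mollify Ω φ f z'‖ ≤ K * ‖z - z'‖ := by
  obtain ⟨K, hK, h⟩ := exists_norm_fderiv_mollify_le hΩ hf
  exact ⟨K, hK, fun φ S hS hSΩ z hz z' hz' =>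
    hS.norm_image_sub_le_of_norm_fderiv_le
      (fun w _ => (hasFDerivAt_mollify hΩ φ hf.1 w).differentiableAt)
      (fun w hw => h φ w (hSΩ w hw)) hz' hz⟩

/-- A directional derivative of the mollification is the mollification of a weak derivative, which
is itself in `W^{1,∞}`; the preceding Lipschitz estimate applies to it. -/
theorem exists_norm_fderiv_mollify_sub_le (hΩ : MeasurableSet Ω) {f : X → F}
    (hf : MemWkInfty Ω 2 f) : ∃ K : ℝ, 0 ≤ K ∧ ∀ (φ : ContDiffBump (0 : X)) (S : Set X),
      Convex ℝ S → (∀ z ∈ S, Metric.closedBall z φ.rOut ⊆ Ω) → ∀ z ∈ S, ∀ z' ∈ S,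
      ‖fderiv ℝ (mollify Ω φ f) z - fderiv ℝ (mollify Ω φ f) z'‖ ≤ K * ‖z - z'‖ := by
  choose g hg hgm using hf.2
  choose G hG0 hG using fun e => exists_norm_mollify_sub_le hΩ (hgm e)
  let b := Module.finBasis ℝ X
  obtain ⟨C, hC, hb⟩ := b.exists_opNorm_le (F := F)
  refine ⟨C * ∑ i, G (b i), mul_nonneg hC.le (Finset.sum_nonneg fun i _ => hG0 _),
    fun φ S hS hSΩ z hz z' hz' => ?_⟩
  rw [mul_assoc]
  refine hb (mul_nonneg (Finset.sum_nonneg fun i _ => hG0 _) (norm_nonneg _)) fun i => ?_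
  rw [sub_apply, fderiv_mollify_apply hΩ φ hf.1 (hg (b i)) (hSΩ z hz),
    fderiv_mollify_apply hΩ φ hf.1 (hg (b i)) (hSΩ z' hz')]
  refine (hG _ φ S hS hSΩ z hz z' hz').trans ?_
  gcongr
  exact Finset.single_le_sum (f := fun i => G (b i)) (fun i _ => hG0 _) (Finset.mem_univ i)

theorem norm_mollify_sub_le [CompleteSpace F] (hΩ : MeasurableSet Ω) (φ : ContDiffBump (0 : X)) {f : X → F}
    (hf : MemLp f ⊤ (volume.restrict Ω)) {z : X} {a : F} {η : ℝ} (hη : 0 ≤ η)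
    (hz : Metric.ball z φ.rOut ⊆ Ω) (h : ∀ w ∈ Metric.ball z φ.rOut, ‖f w - a‖ ≤ η) :
    ‖mollify Ω φ f z - a‖ ≤ η := by
  rw [← dist_eq_norm]
  refine dist_convolution_le hη φ.support_normed_eq.subset φ.nonneg_normed φ.integral_normed
    ((aestronglyMeasurable_indicator_iff hΩ).2 hf.1) fun w hw => ?_
  rw [indicator_of_mem (hz hw), dist_eq_norm]
  exact h w hw

end Mollify

/-! ### Fields in `W^{1,∞}` and `W^{2,∞}` -/

instance : (volume : Measure (ℝ × Plane)).IsAddHaarMeasure :=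
  inferInstanceAs ((volume : Measure ℝ).prod (volume : Measure Plane)).IsAddHaarMeasure

theorem closedBall_subset_halfSpace {r : ℝ} {z : ℝ × Plane} (hz : r < z.1) :
    Metric.closedBall z r ⊆ Ioi (0 : ℝ) ×ˢ (univ : Set Plane) := by
  intro w hw
  refine ⟨?_, mem_univ _⟩
  have h1 : dist w.1 z.1 ≤ r := (le_max_left _ _).trans hw
  have h2 := (abs_le.1 (Real.dist_eq w.1 z.1 ▸ h1)).1
  simp only [mem_Ioi]
  linarith

theorem convex_lt_fst (r : ℝ) : Convex ℝ {z : ℝ × Plane | r < z.1} :=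
  convex_halfSpace_gt (ContinuousLinearMap.fst ℝ ℝ Plane).toLinearMap.isLinear r

/-- The standard bump function of radius `r`. -/
noncomputable def bumpOfRadius {r : ℝ} (hr : 0 < r) : ContDiffBump (0 : ℝ × Plane) :=
  ⟨r / 2, r, by linarith, by linarith⟩

theorem measurableSet_halfSpace : MeasurableSet (Ioi (0 : ℝ) ×ˢ (univ : Set Plane)) :=
  measurableSet_Ioi.prod MeasurableSet.univ

theorem tendsto_mollify {E : ℝ → Plane → Plane} (hE : FieldInWkInfty 1 E) {z : ℝ × Plane}
    (hz : 0 < z.1) {η : ℝ} (hη : 0 < η) : ∃ r₀ > 0, ∀ r (hr : 0 < r), r < r₀ →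
      ‖mollify (Ioi 0 ×ˢ univ) (bumpOfRadius hr) (fun z : ℝ × Plane => E z.1 z.2) z
        - E z.1 z.2‖ ≤ η := by
  have hzΩ : Ici (0 : ℝ) ×ˢ (univ : Set Plane) ∈ nhds z :=
    prod_mem_nhds (Ici_mem_nhds hz) Filter.univ_mem
  obtain ⟨r₁, hr₁, h⟩ := Metric.continuousAt_iff.1 (hE.continuousOn.continuousAt hzΩ) η hη
  refine ⟨min r₁ z.1, lt_min hr₁ hz, fun r hr hlt => ?_⟩
  refine norm_mollify_sub_le measurableSet_halfSpace _ hE.mem.1 hη.le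
    (Metric.ball_subset_closedBall.trans
      (closedBall_subset_halfSpace (hlt.trans_le (min_le_right _ _)))) fun w hw => ?_
  have := h (lt_trans (show dist w z < r from hw) (hlt.trans_le (min_le_left _ _)))
  rw [dist_eq_norm] at this
  exact this.le

/-- Mollifications are Lipschitz with a constant independent of the radius and converge pointwise
for positive times; continuity carries the estimate to `t = 0`. -/
theorem FieldInWkInfty.exists_bddLip {E : ℝ → Plane → Plane} (hE : FieldInWkInfty 1 E) :
    ∃ M L, BddLip E M L := by
  obtain ⟨K, hK, hlip⟩ := exists_norm_mollify_sub_le measurableSet_halfSpace hE.mem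
  obtain ⟨G, hG, hbdd⟩ := exists_ae_bound hE.mem.1
  have hb : ∀ t, 0 < t → ∀ x, ‖E t x‖ ≤ G := by
    intro t ht x
    refine le_of_forall_pos_le_add fun η hη => ?_
    obtain ⟨r, hr, h⟩ := tendsto_mollify hE (z := (t, x)) ht hη
    have h1 := h (r / 2) (half_pos hr) (half_lt_self hr)
    have h2 := norm_mollify_le measurableSet_halfSpace (bumpOfRadius (half_pos hr)) hG hbdd (t, x)
    rw [norm_sub_rev] at h1
    have h3 := norm_le_norm_add_norm_sub' (E t x)
      (mollify (Ioi 0 ×ˢ univ) (bumpOfRadius (half_pos hr)) (fun z : ℝ × Plane => E z.1 z.2) (t, x))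
    simp only at h1
    linarith
  have hl : LipschitzOnWith K.toNNReal (fun z : ℝ × Plane => E z.1 z.2) (Ioi 0 ×ˢ univ) := by
    refine LipschitzOnWith.of_dist_le_mul fun z hz z' hz' => ?_
    rw [Real.coe_toNNReal K hK, dist_eq_norm, dist_eq_norm]
    refine le_of_forall_pos_le_add fun η hη => ?_
    obtain ⟨r₁, hr₁, h₁⟩ := tendsto_mollify hE hz.1 (half_pos hη)
    obtain ⟨r₂, hr₂, h₂⟩ := tendsto_mollify hE hz'.1 (half_pos hη)
    set r₀ := min (min r₁ r₂) (min z.1 z'.1) with hr₀def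
    have hr₀ : 0 < r₀ := lt_min (lt_min hr₁ hr₂) (lt_min hz.1 hz'.1)
    have hr : 0 < r₀ / 2 := half_pos hr₀
    have hlt : r₀ / 2 < r₀ := half_lt_self hr₀
    have e₁ := h₁ (r₀ / 2) hr (hlt.trans_le ((min_le_left _ _).trans (min_le_left _ _)))
    have e₂ := h₂ (r₀ / 2) hr (hlt.trans_le ((min_le_left _ _).trans (min_le_right _ _)))
    have e₃ := hlip (bumpOfRadius hr) {z | r₀ / 2 < z.1} (convex_lt_fst _)
      (fun w hw => closedBall_subset_halfSpace hw)
      z (hlt.trans_le ((min_le_right _ _).trans (min_le_left _ _)))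
      z' (hlt.trans_le ((min_le_right _ _).trans (min_le_right _ _)))
    set m := mollify (Ioi 0 ×ˢ univ) (bumpOfRadius hr) (fun z : ℝ × Plane => E z.1 z.2)
    have : E z.1 z.2 - E z'.1 z'.2 = -(m z - E z.1 z.2) + (m z - m z') + (m z' - E z'.1 z'.2) := by
      abel
    rw [this]
    refine norm_add₃_le.trans ?_
    rw [norm_neg]
    linarith
  have hcl : closure (Ioi (0 : ℝ) ×ˢ (univ : Set Plane)) = Ici 0 ×ˢ univ := by
    rw [closure_prod_eq, closure_Ioi, closure_univ]
  have hl' := hl.closure (by rw [hcl]; exact hE.continuousOn)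
  rw [hcl] at hl'
  have hfin : ∀ s t, 0 ≤ s → 0 ≤ t → ∀ x y, ‖E s x - E t y‖ ≤ (K + 1) * (|s - t| + ‖x - y‖) := by
    intro s t hs ht x y
    have := hl'.dist_le_mul (s, x) ⟨hs, mem_univ _⟩ (t, y) ⟨ht, mem_univ _⟩
    rw [Real.coe_toNNReal K hK, dist_eq_norm, Prod.dist_eq, Real.dist_eq, dist_eq_norm] at this
    refine this.trans ?_
    have hm : max |s - t| ‖x - y‖ ≤ |s - t| + ‖x - y‖ :=
      max_le_add_of_nonneg (abs_nonneg _) (norm_nonneg _)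
    gcongr
    linarith
  -- The bound `G` is known for positive times only; comparing `t` with `t + 1` covers `t = 0`, and
  -- adding 1 to `K` makes both constants positive.
  refine ⟨G + (K + 1), K + 1, by positivity, by positivity, fun t ht x => ?_, hfin⟩
  have h1 := hfin t (t + 1) ht (by positivity) x x
  have h2 := hb (t + 1) (by positivity) x
  have h3 := norm_le_norm_add_norm_sub' (E t x) (E (t + 1) x)
  simp at h1
  linarith

/-- The approximate derivative is the spatial derivative of a mollification at the shifted time `t +
2r`, so that balls of radius `r` stay inside the open half space even for `t = 0`. Only the radius
depends on `δ`; `L` and `K` do not. -/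
theorem FieldInWkInfty.exists_approxDeriv {E : ℝ → Plane → Plane} (hE : FieldInWkInfty 2 E) :
    ∃ M L K, BddLip E M L ∧ 0 ≤ K ∧ ∀ δ > 0, ∃ A, ApproxDeriv E A L K δ := by
  have hE1 : FieldInWkInfty 1 E := ⟨hE.continuousOn, hE.mem.of_succ⟩
  obtain ⟨M, L, hML⟩ := hE1.exists_bddLip
  obtain ⟨L', hL', hbdd⟩ := exists_norm_fderiv_mollify_le measurableSet_halfSpace hE1.mem
  obtain ⟨K, hK, hlip⟩ := exists_norm_fderiv_mollify_sub_le measurableSet_halfSpace hE.mem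
  have hL := hML.lip_pos
  refine ⟨M, L + L', K, ⟨hML.bdd_pos, by positivity, hML.bdd, fun s t hs ht x y =>
    (hML.lip s t hs ht x y).trans (by gcongr; linarith)⟩, hK, fun δ hδ => ?_⟩
  -- Points of the ball differ from `(t, x)` by at most `3r` in time and `r` in space, so the field
  -- changes by at most `4 r L = δ / 2`; a Taylor difference uses this twice.
  have hr : 0 < δ / (8 * L) := by positivity
  set r := δ / (8 * L) with hrdef
  set m := mollify (Ioi 0 ×ˢ univ) (bumpOfRadius hr) (fun z : ℝ × Plane => E z.1 z.2) with hm
  have hS : ∀ t, 0 ≤ t → ∀ x : Plane, r < ((t + 2 * r, x) : ℝ × Plane).1 := fun t ht x => by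
    simp only; linarith
  have hlip' : ∀ z, r < z.1 → ∀ z', r < z'.1 → ‖fderiv ℝ m z - fderiv ℝ m z'‖ ≤ K * ‖z - z'‖ :=
    fun z hz z' hz' => hlip (bumpOfRadius hr) {z | r < z.1} (convex_lt_fst _)
      (fun w hw => closedBall_subset_halfSpace hw) z hz z' hz'
  have happrox : ∀ t, 0 ≤ t → ∀ x, ‖m (t + 2 * r, x) - E t x‖ ≤ δ / 2 := by
    intro t ht x
    have hsub := closedBall_subset_halfSpace (hS t ht x)
    refine norm_mollify_sub_le measurableSet_halfSpace (bumpOfRadius hr) hE.mem.1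
      (by positivity) (Metric.ball_subset_closedBall.trans hsub) fun w hw => ?_
    have hw0 : 0 < w.1 := (hsub (Metric.ball_subset_closedBall hw)).1
    refine (hML.lip w.1 t hw0.le ht w.2 x).trans ?_
    have hw' : max (dist w.1 (t + 2 * r)) (dist w.2 x) < r := hw
    have h1 : |w.1 - (t + 2 * r)| < r := by
      rw [← Real.dist_eq]; exact (le_max_left _ _).trans_lt hw'
    have h2 : ‖w.2 - x‖ < r := by
      rw [← dist_eq_norm]; exact (le_max_right _ _).trans_lt hw'
    have h3 : |w.1 - t| + ‖w.2 - x‖ ≤ 4 * r := by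
      have h1' := abs_lt.1 h1
      have : |w.1 - t| ≤ 3 * r := abs_le.2 ⟨by linarith, by linarith⟩
      linarith
    calc L * (|w.1 - t| + ‖w.2 - x‖) ≤ L * (4 * r) := by gcongr
      _ = δ / 2 := by rw [hrdef]; field_simp; norm_num
  have hnorm : ∀ h : Plane, ‖((0, h) : ℝ × Plane)‖ = ‖h‖ := fun h => by simp [Prod.norm_def]
  refine ⟨fun t x => (fderiv ℝ m (t + 2 * r, x)).comp (ContinuousLinearMap.inr ℝ ℝ Plane),
    ⟨fun t ht x h => ?_, fun t ht x h => ?_, fun s t hs ht x y h => ?_⟩⟩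
  · have h1 := hbdd (bumpOfRadius hr) (t + 2 * r, x) (closedBall_subset_halfSpace (hS t ht x))
    have h2 := (fderiv ℝ m (t + 2 * r, x)).le_of_opNorm_le h1 (0, h)
    rw [hnorm] at h2
    refine h2.trans ?_
    gcongr
    linarith
  · set z : ℝ × Plane := (t + 2 * r, x)
    set z' : ℝ × Plane := (t + 2 * r, x + h)
    have hzz : z' - z = (0, h) := by simp [z, z']
    have h1 := (convex_segment z z').norm_image_sub_le_of_norm_fderiv_le' (f := m)
      (φ := fderiv ℝ m z) (C := K * ‖h‖)
      (fun w _ => (hasFDerivAt_mollify measurableSet_halfSpace _ hE.mem.1 w).differentiableAt)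
      (fun w hw => by
        refine (hlip' w ((convex_lt_fst r).segment_subset (hS t ht x) (hS t ht (x + h)) hw) z
          (hS t ht x)).trans ?_
        gcongr
        rw [← hnorm h, ← hzz]
        exact norm_sub_le_of_mem_segment hw)
      (left_mem_segment ℝ z z') (right_mem_segment ℝ z z')
    rw [hzz, hnorm] at h1
    have h2 := happrox t ht x
    have h3 := happrox t ht (x + h)
    rw [show E t (x + h) - E t x - ((fderiv ℝ m z).comp (ContinuousLinearMap.inr ℝ ℝ Plane)) h =
      -(m z' - E t (x + h)) + (m z - E t x) + (m z' - m z - fderiv ℝ m z (0, h)) by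
        simp only [ContinuousLinearMap.comp_apply, ContinuousLinearMap.inr_apply]; abel]
    refine norm_add₃_le.trans ?_
    rw [norm_neg]
    nlinarith
  · have h1 := hlip' (s + 2 * r, x) (hS s hs x) (t + 2 * r, y) (hS t ht y)
    have h2 := (fderiv ℝ m (s + 2 * r, x) - fderiv ℝ m (t + 2 * r, y)).le_of_opNorm_le h1 (0, h)
    rw [hnorm] at h2
    refine h2.trans ?_
    gcongr
    rw [Prod.mk_sub_mk, add_sub_add_right_eq_sub, Prod.norm_def, Real.norm_eq_abs]
    exact max_le_add_of_nonneg (abs_nonneg _) (norm_nonneg _)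

/-! ### Uniform estimates -/

section Uniform

variable {E : ℝ → Plane → Plane}

theorem exists_error_bound (hE : FieldInWkInfty 1 E) (T V : ℝ) : ∃ C : ℝ, 0 < C ∧
    ∀ (x₀ v₀ : Plane), ‖v₀‖ ≤ V → ∀ (ε Δt : ℝ), 0 < ε → 0 < Δt →
    ∀ (x v : ℝ → Plane), IsCharacteristic E ε x₀ v₀ x v →
    ∀ (xd vd : ℕ → Plane), IsImexScheme E ε Δt x₀ v₀ xd vd →
    ∀ n : ℕ, n * Δt ≤ T →
      ‖guidingCenter ε (xd n) (vd n) - guidingCenter ε (x (n * Δt)) (v (n * Δt))‖ ≤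
        C * (Δt * (1 + (ε ^ 3)⁻¹)) ∧
      ‖xd n - x (n * Δt)‖ ≤ C * (Δt * (1 + (ε ^ 3)⁻¹)) ∧
      ‖xd n - x (n * Δt)‖ ≤ C * (Δt + ε * (1 + ε)) := by
  obtain ⟨M, L, hML⟩ := hE.exists_bddLip
  -- The absolute value gives a nonnegative constant for arbitrary real `T` and `V`.
  set B := |velocityBound M L T V|
  set C₁ := Real.exp (2 * L * T) * T * (2 * L + 4 * (L * B) + M + 2 * B)
  set C₂ := Real.exp (L * T) * (T * L * (1 + M + 2 * B)) + 2 * B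
  refine ⟨1 + |C₁| + |C₂|, by positivity, fun x₀ v₀ hV ε Δt hε hΔ x v h xd vd hd n hn => ?_⟩
  have hv : ∀ t, 0 ≤ t → t ≤ T → ‖v t‖ ≤ B * (1 + ε) := fun t ht htT =>
    (h.norm_v_le hML hε hV ht htT).trans (by gcongr; exact le_abs_self _)
  have hvd : ∀ n : ℕ, n * Δt ≤ T → ‖vd n‖ ≤ B * (1 + ε) := fun n hn =>
    (hd.norm_v_le hML hε hΔ hV hn).trans (by gcongr; exact le_abs_self _)
  have h1 := error_le_of_smooth_regime hML hε hΔ (abs_nonneg _) h hd hv hn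
  have h2 := error_le_of_stiff_regime hML hε hΔ (abs_nonneg _) h hd hv hvd hn
  have hc1 : C₁ ≤ 1 + |C₁| + |C₂| := by linarith [le_abs_self C₁, abs_nonneg C₂]
  have hc2 : C₂ ≤ 1 + |C₁| + |C₂| := by linarith [le_abs_self C₂, abs_nonneg C₁]
  have h1' := h1.trans (mul_le_mul_of_nonneg_right hc1
    (by positivity : 0 ≤ Δt * (1 + (ε ^ 3)⁻¹)))
  have h2' := h2.trans (mul_le_mul_of_nonneg_right hc2 (by positivity : 0 ≤ Δt + ε * (1 + ε)))
  have h3 : 0 ≤ ε * ‖vd n - v (n * Δt)‖ := by positivity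
  exact ⟨by linarith, (norm_sub_le_guidingCenter hε _ _ _ _).trans h1', h2'⟩

theorem exists_guidingCenter_error_bound (hE : FieldInWkInfty 2 E) (T V : ℝ) : ∃ C : ℝ, 0 < C ∧
    ∀ (x₀ v₀ : Plane), ‖v₀‖ ≤ V → ∀ (ε Δt : ℝ), 0 < ε → 0 < Δt →
    ∀ (x v : ℝ → Plane), IsCharacteristic E ε x₀ v₀ x v →
    ∀ (xd vd : ℕ → Plane), IsImexScheme E ε Δt x₀ v₀ xd vd →
    ∀ n : ℕ, n * Δt ≤ T →
      ‖guidingCenter ε (xd n) (vd n) - guidingCenter ε (x (n * Δt)) (v (n * Δt))‖ ≤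
        C * (Δt * (1 + (ε ^ 3)⁻¹)) ∧
      ‖guidingCenter ε (xd n) (vd n) - guidingCenter ε (x (n * Δt)) (v (n * Δt))‖ ≤
        C * ((Δt + ε ^ 2) * (1 + ε ^ 2)) := by
  obtain ⟨C₁, hC₁, hbound⟩ := exists_error_bound ⟨hE.continuousOn, hE.mem.of_succ⟩ T V
  obtain ⟨M, L, K, hML, hK, hA⟩ := hE.exists_approxDeriv
  set B := |velocityBound M L T V|
  set C₂ := Real.exp (L * T) * (2 * M + 4 * L * B + T * (4 * L ^ 2 * B + 2 * (2 * K * B ^ 2 + 1 +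
        (1 + M) * (L + 2 * K * B) + L * M + 2 * K * (1 + M) * B))) + 4 * L * B
  refine ⟨C₁ + |C₂|, by positivity, fun x₀ v₀ hV ε Δt hε hΔ x v h xd vd hd n hn => ⟨?_, ?_⟩⟩
  · refine (hbound x₀ v₀ hV ε Δt hε hΔ x v h xd vd hd n hn).1.trans ?_
    gcongr
    exact le_add_of_nonneg_right (abs_nonneg _)
  · cases n with
    | zero =>
      simp only [Nat.cast_zero, zero_mul, hd.init_x, hd.init_v, h.init_x, h.init_v, sub_self,
        norm_zero]
      positivity
    | succ n =>
      -- Accuracy `δ = Δt` is enough: the Taylor error then has the size of the Euler truncation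
      -- error.
      obtain ⟨A, hA⟩ := hA Δt hΔ
      refine (guidingCenter_error_le hML hA hε hΔ hK (abs_nonneg _) h hd
        (fun t ht htT => (h.norm_v_le hML hε hV ht htT).trans (by gcongr; exact le_abs_self _))
        (fun n hn => (hd.norm_v_le hML hε hΔ hV hn).trans (by gcongr; exact le_abs_self _))
        hn).trans (mul_le_mul_of_nonneg_right (?_ : C₂ ≤ C₁ + |C₂|) (by positivity))
      linarith [le_abs_self C₂]

theorem smooth_rate_le {ε Δt : ℝ} (hε : 0 < ε) (hΔ : 0 < Δt) {a : ℝ} (ha : 1 + ε ^ 3 ≤ a) :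
    Δt * (1 + (ε ^ 3)⁻¹) ≤ Δt / ε ^ 3 * a := by
  have : Δt * (1 + (ε ^ 3)⁻¹) = Δt / ε ^ 3 * (1 + ε ^ 3) := by field_simp; ring
  rw [this]
  gcongr

/-- With `q = Δt^(1/4)`, the first bound is at most `q + q⁴` when `q ≤ ε`, and the second at most `q
+ q² + q⁴` when `ε < q`. Higher powers of `q` are absorbed using `Δt ≤ |T|`. -/
theorem min_rate_fourth_le {ε Δt T e C : ℝ} (hε : 0 < ε) (hΔ : 0 < Δt) (hT : Δt ≤ |T|)
    (hC : 0 < C) (h1 : e ≤ C * (Δt * (1 + (ε ^ 3)⁻¹))) (h2 : e ≤ C * (Δt + ε * (1 + ε))) :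
    e ≤ C * (1 + |T| ^ (1 / 4 : ℝ) + (|T| ^ (1 / 4 : ℝ)) ^ 3) * Δt ^ (1 / 4 : ℝ) := by
  have hqP : Δt ^ (1 / 4 : ℝ) ≤ |T| ^ (1 / 4 : ℝ) := by gcongr
  have hq4 : (Δt ^ (1 / 4 : ℝ)) ^ 4 = Δt := by
    rw [← Real.rpow_natCast, ← Real.rpow_mul hΔ.le]; norm_num
  have hq : 0 < Δt ^ (1 / 4 : ℝ) := by positivity
  set q := Δt ^ (1 / 4 : ℝ)
  set P := |T| ^ (1 / 4 : ℝ)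
  have hP : 0 < P := hq.trans_le hqP
  rw [mul_assoc]
  rcases le_or_gt q ε with hqε | hqε
  · refine h1.trans ?_
    refine mul_le_mul_of_nonneg_left ?_ hC.le
    calc Δt * (1 + (ε ^ 3)⁻¹) ≤ q ^ 4 * (1 + (q ^ 3)⁻¹) := by rw [hq4]; gcongr
      _ = (1 + q ^ 3) * q := by field_simp; ring
      _ ≤ (1 + P + P ^ 3) * q := by
        gcongr
        linarith
  · refine h2.trans ?_
    refine mul_le_mul_of_nonneg_left ?_ hC.le
    calc Δt + ε * (1 + ε) ≤ q ^ 4 + q * (1 + q) := by rw [hq4]; gcongr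
      _ = (1 + q + q ^ 3) * q := by ring
      _ ≤ (1 + P + P ^ 3) * q := by gcongr

/-- The balance is now at `q = Δt^(1/5)`, where both `Δt / ε³` and `ε²` equal `q²`. -/
theorem min_rate_two_fifths_le {ε Δt T e C : ℝ} (hε : 0 < ε) (hΔ : 0 < Δt) (hT : Δt ≤ |T|)
    (hC : 0 < C) (h1 : e ≤ C * (Δt * (1 + (ε ^ 3)⁻¹)))
    (h2 : e ≤ C * ((Δt + ε ^ 2) * (1 + ε ^ 2))) :
    e ≤ C * ((1 + (|T| ^ (1 / 5 : ℝ)) ^ 3) * (1 + (|T| ^ (1 / 5 : ℝ)) ^ 2)) *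
      Δt ^ (2 / 5 : ℝ) := by
  have hqP : Δt ^ (1 / 5 : ℝ) ≤ |T| ^ (1 / 5 : ℝ) := by gcongr
  have hq5 : (Δt ^ (1 / 5 : ℝ)) ^ 5 = Δt := by
    rw [← Real.rpow_natCast, ← Real.rpow_mul hΔ.le]; norm_num
  have hq2 : Δt ^ (2 / 5 : ℝ) = (Δt ^ (1 / 5 : ℝ)) ^ 2 := by
    rw [← Real.rpow_natCast, ← Real.rpow_mul hΔ.le]; norm_num
  have hq : 0 < Δt ^ (1 / 5 : ℝ) := by positivity
  rw [hq2, mul_assoc]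
  set q := Δt ^ (1 / 5 : ℝ)
  set P := |T| ^ (1 / 5 : ℝ)
  have hP : 0 < P := hq.trans_le hqP
  rcases le_or_gt q ε with hqε | hqε
  · refine h1.trans ?_
    refine mul_le_mul_of_nonneg_left ?_ hC.le
    calc Δt * (1 + (ε ^ 3)⁻¹) ≤ q ^ 5 * (1 + (q ^ 3)⁻¹) := by rw [hq5]; gcongr
      _ = ((1 + q ^ 3) * 1) * q ^ 2 := by field_simp; ring
      _ ≤ ((1 + P ^ 3) * (1 + P ^ 2)) * q ^ 2 := by
        gcongr
        linarith [sq_nonneg P]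
  · refine h2.trans ?_
    refine mul_le_mul_of_nonneg_left ?_ hC.le
    calc (Δt + ε ^ 2) * (1 + ε ^ 2) ≤ (q ^ 5 + q ^ 2) * (1 + q ^ 2) := by rw [hq5]; gcongr
      _ = ((1 + q ^ 3) * (1 + q ^ 2)) * q ^ 2 := by ring
      _ ≤ ((1 + P ^ 3) * (1 + P ^ 2)) * q ^ 2 := by gcongr

theorem le_abs_of_succ_mul_le {Δt T : ℝ} (hΔ : 0 < Δt) {n : ℕ} (hn : (n + 1 : ℕ) * Δt ≤ T) :
    Δt ≤ |T| := by
  refine le_trans ?_ (hn.trans (le_abs_self T))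
  push_cast
  have : 0 ≤ n * Δt := by positivity
  linarith

end Uniform

/-! ### The regimes of `Δt` relative to `ε`, and the uniform rates. -/

theorem corollary3p2 (E : ℝ → Plane → Plane) :
    -- error on the space variable
    (FieldInWkInfty 1 E → ∀ T V : ℝ,
      (∀ c : ℝ, 0 < c → ∃ C : ℝ, 0 < C ∧
        ∀ (x₀ v₀ : Plane), ‖v₀‖ ≤ V → ∀ (ε Δt : ℝ), 0 < ε → 0 < Δt →
        ∀ (x v : ℝ → Plane), IsCharacteristic E ε x₀ v₀ x v →
        ∀ (xd vd : ℕ → Plane), IsImexScheme E ε Δt x₀ v₀ xd vd →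
        ∀ n : ℕ, n * Δt ≤ T →
          (Δt ≤ c * ε ^ 4 →
            ‖xd n - x (n * Δt)‖ ≤ C * ((1 + ε) * (Δt / ε ^ 3 * (1 + ε ^ 2)))) ∧
          (c⁻¹ * ε ^ 4 ≤ Δt → Δt ≤ c * ε →
            ‖xd n - x (n * Δt)‖ ≤ C * ((1 + ε) * ε)) ∧
          (c⁻¹ * ε ≤ Δt →
            ‖xd n - x (n * Δt)‖ ≤ C * ((1 + ε) * Δt))) ∧
      (∃ C : ℝ, 0 < C ∧
        ∀ (x₀ v₀ : Plane), ‖v₀‖ ≤ V → ∀ (ε Δt : ℝ), 0 < ε → 0 < Δt →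
        ∀ (x v : ℝ → Plane), IsCharacteristic E ε x₀ v₀ x v →
        ∀ (xd vd : ℕ → Plane), IsImexScheme E ε Δt x₀ v₀ xd vd →
        ∀ n : ℕ, n * Δt ≤ T →
          ‖xd n - x (n * Δt)‖ ≤ C * Δt ^ (1 / 4 : ℝ))) ∧
    -- error on the guiding center variable
    (FieldInWkInfty 2 E → ∀ T V : ℝ,
      (∀ c : ℝ, 0 < c → ∃ C : ℝ, 0 < C ∧
        ∀ (x₀ v₀ : Plane), ‖v₀‖ ≤ V → ∀ (ε Δt : ℝ), 0 < ε → 0 < Δt →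
        ∀ (x v : ℝ → Plane), IsCharacteristic E ε x₀ v₀ x v →
        ∀ (xd vd : ℕ → Plane), IsImexScheme E ε Δt x₀ v₀ xd vd →
        ∀ n : ℕ, n * Δt ≤ T →
          (Δt ≤ c * ε ^ 5 →
            ‖guidingCenter ε (xd n) (vd n) - guidingCenter ε (x (n * Δt)) (v (n * Δt))‖ ≤
              C * ((1 + ε ^ 2) * (Δt / ε ^ 3 * (1 + ε)))) ∧
          (c⁻¹ * ε ^ 5 ≤ Δt → Δt ≤ c * ε ^ 2 →
            ‖guidingCenter ε (xd n) (vd n) - guidingCenter ε (x (n * Δt)) (v (n * Δt))‖ ≤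
              C * ((1 + ε ^ 2) * ε ^ 2)) ∧
          (c⁻¹ * ε ^ 2 ≤ Δt →
            ‖guidingCenter ε (xd n) (vd n) - guidingCenter ε (x (n * Δt)) (v (n * Δt))‖ ≤
              C * ((1 + ε ^ 2) * Δt))) ∧
      (∃ C : ℝ, 0 < C ∧
        ∀ (x₀ v₀ : Plane), ‖v₀‖ ≤ V → ∀ (ε Δt : ℝ), 0 < ε → 0 < Δt →
        ∀ (x v : ℝ → Plane), IsCharacteristic E ε x₀ v₀ x v →
        ∀ (xd vd : ℕ → Plane), IsImexScheme E ε Δt x₀ v₀ xd vd →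
        ∀ n : ℕ, n * Δt ≤ T →
          ‖guidingCenter ε (xd n) (vd n) - guidingCenter ε (x (n * Δt)) (v (n * Δt))‖ ≤
            C * Δt ^ (2 / 5 : ℝ))) := by
  refine ⟨fun hE T V => ?_, fun hE T V => ?_⟩
  · obtain ⟨C, hC, hbound⟩ := exists_error_bound hE T V
    refine ⟨fun c hc => ⟨C * (1 + c), by positivity,
      fun x₀ v₀ hV ε Δt hε hΔ x v h xd vd hd n hn => ?_⟩,
      ⟨C * (1 + |T| ^ (1 / 4 : ℝ) + (|T| ^ (1 / 4 : ℝ)) ^ 3), by positivity,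
      fun x₀ v₀ hV ε Δt hε hΔ x v h xd vd hd n hn => ?_⟩⟩
    · obtain ⟨-, h1, h2⟩ := hbound x₀ v₀ hV ε Δt hε hΔ x v h xd vd hd n hn
      refine ⟨fun _ => h1.trans ?_, fun _ hcε => h2.trans ?_, fun hcε => h2.trans ?_⟩
      · have h3 : Δt * (1 + (ε ^ 3)⁻¹) ≤ Δt / ε ^ 3 * ((1 + ε) * (1 + ε ^ 2)) :=
          smooth_rate_le hε hΔ (by nlinarith [sq_nonneg ε])
        rw [mul_assoc]
        refine mul_le_mul_of_nonneg_left ?_ hC.le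
        calc _ ≤ 1 * (Δt / ε ^ 3 * ((1 + ε) * (1 + ε ^ 2))) := by rwa [one_mul]
          _ ≤ (1 + c) * (Δt / ε ^ 3 * ((1 + ε) * (1 + ε ^ 2))) := by gcongr; linarith
          _ = _ := by ring
      · rw [mul_assoc]
        refine mul_le_mul_of_nonneg_left ?_ hC.le
        have : 0 ≤ c * ε * ε := by positivity
        linarith
      · have hε' : ε ≤ c * Δt := by rwa [inv_mul_le_iff₀ hc] at hcε
        rw [mul_assoc]
        refine mul_le_mul_of_nonneg_left ?_ hC.le
        have h3 : ε * (1 + ε) ≤ c * Δt * (1 + ε) := by gcongr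
        have : 0 ≤ Δt * ε := by positivity
        linarith
    -- For `n = 0` the time step may exceed `|T|`, but the error vanishes; for larger `n`, `t_n ≤ T`
    -- forces `Δt ≤ |T|`.
    · cases n with
      | zero =>
        simp only [Nat.cast_zero, zero_mul, hd.init_x, h.init_x, sub_self, norm_zero]
        positivity
      | succ n =>
        obtain ⟨-, h1, h2⟩ := hbound x₀ v₀ hV ε Δt hε hΔ x v h xd vd hd _ hn
        exact min_rate_fourth_le hε hΔ (le_abs_of_succ_mul_le hΔ hn) hC h1 h2
  · obtain ⟨C, hC, hbound⟩ := exists_guidingCenter_error_bound hE T V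
    refine ⟨fun c hc => ⟨C * (1 + c), by positivity,
      fun x₀ v₀ hV ε Δt hε hΔ x v h xd vd hd n hn => ?_⟩,
      ⟨C * ((1 + (|T| ^ (1 / 5 : ℝ)) ^ 3) * (1 + (|T| ^ (1 / 5 : ℝ)) ^ 2)), by positivity,
      fun x₀ v₀ hV ε Δt hε hΔ x v h xd vd hd n hn => ?_⟩⟩
    · obtain ⟨h1, h2⟩ := hbound x₀ v₀ hV ε Δt hε hΔ x v h xd vd hd n hn
      refine ⟨fun _ => h1.trans ?_, fun _ hcε => h2.trans ?_, fun hcε => h2.trans ?_⟩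
      · have h3 : Δt * (1 + (ε ^ 3)⁻¹) ≤ Δt / ε ^ 3 * ((1 + ε) * (1 + ε ^ 2)) :=
          smooth_rate_le hε hΔ (by nlinarith [sq_nonneg ε])
        rw [mul_assoc]
        refine mul_le_mul_of_nonneg_left ?_ hC.le
        calc _ ≤ 1 * (Δt / ε ^ 3 * ((1 + ε) * (1 + ε ^ 2))) := by rwa [one_mul]
          _ ≤ (1 + c) * (Δt / ε ^ 3 * ((1 + ε) * (1 + ε ^ 2))) := by gcongr; linarith
          _ = _ := by ring
      · rw [mul_assoc]
        refine mul_le_mul_of_nonneg_left ?_ hC.le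
        calc (Δt + ε ^ 2) * (1 + ε ^ 2) ≤ (c * ε ^ 2 + ε ^ 2) * (1 + ε ^ 2) := by gcongr
          _ = _ := by ring
      · have hε' : ε ^ 2 ≤ c * Δt := by rwa [inv_mul_le_iff₀ hc] at hcε
        rw [mul_assoc]
        refine mul_le_mul_of_nonneg_left ?_ hC.le
        calc (Δt + ε ^ 2) * (1 + ε ^ 2) ≤ (Δt + c * Δt) * (1 + ε ^ 2) := by gcongr
          _ = _ := by ring
    · cases n with
      | zero =>
        simp only [Nat.cast_zero, zero_mul, hd.init_x, h.init_x, hd.init_v, h.init_v, sub_self,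
          norm_zero]
        positivity
      | succ n =>
        obtain ⟨h1, h2⟩ := hbound x₀ v₀ hV ε Δt hε hΔ x v h xd vd hd _ hn
        exact min_rate_two_fifths_le hε hΔ (le_abs_of_succ_mul_le hΔ hn) hC h1 h2
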